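/- Let $(E_n)_{n\ge 0}$ be measurable spaces, $\mathcal B_b(E_n)$ the bounded measurable real functions on $E_n$, $\eta_0$ a probability measure on $E_0$ and $d\ge 0$. For $n\ge 0$ and $\zeta\in\mathbb R^d$ let $M_{n+1,\zeta}$ be a Markov kernel from $E_n$ to $E_{n+1}$, $G_{n,\zeta}:E_n\to(0,\infty)$ a measurable function, $\xi_{n+1}:E_n\to\mathbb R^d$ a measurable statistic, and $\mathrm{Dom}(\xi_{n+1})\subset\mathbb R^d$ a convex set containing the range of $\xi_{n+1}$. Put $Q_{n+1,\zeta}\varphi(x)=G_{n,\zeta}(x)\int\varphi(y)\,M_{n+1,\zeta}(x,dy)$. *Limiting quantities.* Define recursively $\gamma_n(\varphi)=\mathbb E\big[\prod_{p=0}^{n-1}G_p(X_p)\,\varphi(X_n)\big]$ and $\eta_n=\gamma_n/\gamma_n(1)$, where $X_0\sim\eta_0$ and $(X_n)$ is the Markov chain with transitions $M_n=M_{n,\eta_{n-1}(\xi_n)}$, and $G_n=G_{n,\eta_n(\xi_{n+1})}$. Write $Q_n=Q_{n,\eta_{n-1}(\xi_n)}$ and let $\partial_\xi Q_n\varphi$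 be $\partial_\zeta Q_{n,\zeta}\varphi$ evaluated at $\zeta=\eta_{n-1}(\xi_n)$. Define $$\mathscr L_p\varphi=\eta_{p-1}[\partial_\xi Q_p\varphi]\,\big(\xi_p-\eta_{p-1}(\xi_p)\big)+Q_p\varphi,\qquad \mathscr L_{p,n}=\mathscr L_{p+1}\circ\cdots\circ\mathscr L_n,\qquad \mathscr L_{n,n}=\mathrm{Id}.$$ *Particle system.* For $N\ge1$ let $x_0^1,\dots,x_0^N$ be i.i.d. with law $\eta_0$ and, given the particles up to time $n-1$, let $x_n^1,\dots,x_n^N$ be i.i.d. with law $$\Phi_{n,N}(\eta_{n-1}^N)(dy)=\frac{\eta^N_{n-1}(G_{n-1,N}M_{n,N})(dy)}{\eta^N_{n-1}(G_{n-1,N})},\qquad \eta_n^N=\frac1N\sum_{i=1}^N\delta_{x_n^i},$$ where $M_{n,N}=M_{n,\eta_{n-1}^N(\xi_n)}$ and $G_{n,N}=G_{n,\eta_n^N(\xi_{n+1})}$. Put $\gamma_n^N(\varphi)=\big\{\prod_{p=0}^{n-1}\eta_p^N(G_{p,N})\big\}\,\eta_n^N(\varphi)$. A function $f$ on $E_n\times\mathrm{Dom}(\xi_{n+1})$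 is called *continuous at $\zeta_0$ uniformly over $x$* if $\sup_{x\in E_n,\ |\zeta-\zeta_0|<\delta}|f(x,\zeta)-f(x,\zeta_0)|\to0$ as $\delta\to0^+$. Assume, for every $n\ge0$ and every $\varphi\in\mathcal B_b(E_{n+1})$: (A1) $\xi_{n+1}$ is bounded, and the functions $(x,\zeta)\mapsto G_{n,\zeta}(x)$ and $(x,\zeta)\mapsto Q_{n+1,\zeta}\varphi(x)$ are bounded on $E_n\times\mathrm{Dom}(\xi_{n+1})$ and continuous at $\zeta=\eta_n(\xi_{n+1})$ uniformly over $x\in E_n$; (A2) the derivative $(x,\zeta)\mapsto\partial_\zeta Q_{n+1,\zeta}\varphi(x)$ exists on $E_n\times\mathrm{Dom}(\xi_{n+1})$, is bounded there, and is continuous at $\zeta=\eta_n(\xi_{n+1})$ uniformly over $x\in E_n$. Then, for every $n\ge0$, the law of the particle system up to time $n$ is a well-defined probability measure, and as $N\to\infty$ $$\sqrt N\,\Big\{\frac{\gamma_n^N(1)}{\gamma_n(1)}-1\Big\}$$ converges in distribution to a centred (possibly degenerate) Gaussian with variance $$\sum_{p=0}^n\frac{\mathrm{Var}_{\eta_p}(\mathscr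 L_{p,n}1)}{\prod_{k=p}^{n-1}\eta_k(G_k)^2}.$$ -/

import Mathlib

open MeasureTheory ProbabilityTheory Filter Topology
open scoped ENNReal NNReal

/-- Trajectories `(x₀, …, xₙ)` with `xₚ ∈ E p`, as the iterated product
`(…(E 0 × E 1) × …) × E n`. -/
def Hist (E : ℕ → Type*) : ℕ → Type _
  | 0 => E 0
  | n + 1 => Hist E n × E (n + 1)

/-- The product σ-algebra on trajectories. -/
instance Hist.instMeasurableSpace (E : ℕ → Type*) [∀ n, MeasurableSpace (E n)] :
    ∀ n, MeasurableSpace (Hist E n)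
  | 0 => inferInstanceAs (MeasurableSpace (E 0))
  | n + 1 =>
    letI := Hist.instMeasurableSpace E n
    inferInstanceAs (MeasurableSpace (Hist E n × E (n + 1)))

/-- The last point `xₙ` of a trajectory `(x₀, …, xₙ)`. -/
def Hist.last {E : ℕ → Type*} : ∀ {n : ℕ}, Hist E n → E n
  | 0, h => h
  | _ + 1, h => h.2

theorem Hist.measurable_last {E : ℕ → Type*} [∀ n, MeasurableSpace (E n)] :
    ∀ {n : ℕ}, Measurable (Hist.last : Hist E n → E n)
  | 0 => measurable_id
  | _ + 1 => measurable_snd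

/-- The class `𝓑_b(X)` of bounded measurable real functions. -/
def IsBddMeasurable {X : Type*} [MeasurableSpace X] (φ : X → ℝ) : Prop :=
  Measurable φ ∧ ∃ C : ℝ, ∀ x, |φ x| ≤ C

/-- `f : X × D → Z` is bounded. -/
def IsBddOn {X Y Z : Type*} [Norm Z] (D : Set Y) (f : X → Y → Z) : Prop :=
  ∃ C : ℝ, ∀ x, ∀ y ∈ D, ‖f x y‖ ≤ C

/-- `f : X × D → Z` is continuous at `y₀` uniformly over `x ∈ X`. -/
def ContinuousAtUniformly {X Y Z : Type*} [PseudoMetricSpace Y] [PseudoMetricSpace Z]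
    (D : Set Y) (f : X → Y → Z) (y₀ : Y) : Prop :=
  ∀ ε > 0, ∃ δ > 0, ∀ x, ∀ y ∈ D, dist y y₀ < δ → dist (f x y) (f x y₀) < ε

/-- The ingredients of adaptive sequential Monte Carlo through summary statistics.
Indexing: `M n ζ` is the Markov kernel from `E n` to `E (n + 1)` (usually written `M_{n+1,ζ}`),
`G n ζ` is the potential on `E n`, and `stat n` is the summary statistic on `E n`
(usually written `ξ_{n+1}`), whose range is contained in the convex set `Dom n`. -/
structure AdaptiveSMC (d : ℕ) (E : ℕ → Type*) [∀ n, MeasurableSpace (E n)] where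
  /-- the initial distribution `η₀` -/
  init : Measure (E 0)
  init_prob : IsProbabilityMeasure init
  M : ∀ n, EuclideanSpace ℝ (Fin d) → Kernel (E n) (E (n + 1))
  M_markov : ∀ n ζ, IsMarkovKernel (M n ζ)
  G : ∀ n, EuclideanSpace ℝ (Fin d) → E n → ℝ
  G_meas : ∀ n ζ, Measurable (G n ζ)
  G_pos : ∀ n ζ x, 0 < G n ζ x
  stat : ∀ n, E n → EuclideanSpace ℝ (Fin d)
  stat_meas : ∀ n, Measurable (stat n)
  Dom : ℕ → Set (EuclideanSpace ℝ (Fin d))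
  Dom_convex : ∀ n, Convex ℝ (Dom n)
  stat_mem : ∀ n x, stat n x ∈ Dom n

namespace AdaptiveSMC

variable {d : ℕ} {E : ℕ → Type*} [∀ n, MeasurableSpace (E n)]

noncomputable section

/-! ### The limiting (Feynman–Kac) quantities -/

/-- Given the law `s.1` of a chain `(X₀, …, Xₙ)` and a weight `s.2 = w(X₀, …, Xₙ)`, the measure
`A ↦ 𝔼[w(X₀, …, Xₙ) 1_A(Xₙ)]`. -/
def terminal {n : ℕ} (s : Measure (Hist E n) × (Hist E n → ℝ≥0∞)) : Measure (E n) :=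
  (s.1.withDensity s.2).map Hist.last

/-- The probability measure proportional to `μ`. -/
def normalise {X : Type*} [MeasurableSpace X] (μ : Measure X) : Measure X :=
  (μ Set.univ)⁻¹ • μ

/-- The law of the Markov chain `(X₀, …, Xₙ)` with transitions `M_{k, η_{k-1}(ξ_k)}`, together with
the weight `∏_{p < n} G_p(X_p)`, where `G_p = G_{p, η_p(ξ_{p+1})}`. The parameter used in the step
from `n` to `n + 1` is the mean of the statistic on `E n` under the normalised terminal measure. -/
def feynmanKac (S : AdaptiveSMC d E) : ∀ n, Measure (Hist E n) × (Hist E n → ℝ≥0∞)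
  | 0 => (S.init, fun _ => 1)
  | n + 1 =>
    let s := feynmanKac S n
    let θ := ∫ x, S.stat n x ∂(normalise (terminal s))
    (s.1 ⊗ₘ ((S.M n θ).comap Hist.last Hist.measurable_last),
      fun h => s.2 h.1 * ENNReal.ofReal (S.G n θ (Hist.last h.1)))

/-- The unnormalised measure `γ_n(φ) = 𝔼[∏_{p < n} G_p(X_p) φ(X_n)]`. -/
def gamma (S : AdaptiveSMC d E) (n : ℕ) : Measure (E n) := terminal (S.feynmanKac n)

/-- `η_n = γ_n / γ_n(1)`. -/
def eta (S : AdaptiveSMC d E) (n : ℕ) : Measure (E n) := normalise (S.gamma n)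

/-- The limiting parameter value `η_n(ξ_{n+1})`. -/
def theta (S : AdaptiveSMC d E) (n : ℕ) : EuclideanSpace ℝ (Fin d) :=
  ∫ x, S.stat n x ∂(S.eta n)

theorem feynmanKac_succ (S : AdaptiveSMC d E) (n : ℕ) :
    S.feynmanKac (n + 1) =
      ((S.feynmanKac n).1 ⊗ₘ ((S.M n (S.theta n)).comap Hist.last Hist.measurable_last),
        fun h => (S.feynmanKac n).2 h.1 * ENNReal.ofReal (S.G n (S.theta n) (Hist.last h.1))) :=
  rfl

/-- `Q_{n+1,ζ} φ (x) = G_{n,ζ}(x) ∫ φ(y) M_{n+1,ζ}(x, dy)`. -/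
def Q (S : AdaptiveSMC d E) (n : ℕ) (ζ : EuclideanSpace ℝ (Fin d)) (φ : E (n + 1) → ℝ)
    (x : E n) : ℝ :=
  S.G n ζ x * ∫ y, φ y ∂(S.M n ζ x)

/-- `∂_ζ Q_{n+1,ζ} φ (x)`, the derivative in the parameter `ζ ∈ ℝ^d`. -/
def dQ (S : AdaptiveSMC d E) (n : ℕ) (ζ : EuclideanSpace ℝ (Fin d)) (φ : E (n + 1) → ℝ)
    (x : E n) : EuclideanSpace ℝ (Fin d) →L[ℝ] ℝ :=
  fderiv ℝ (fun ζ' => S.Q n ζ' φ x) ζ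

/-- The operator `𝓛_{n+1}`:
`φ ↦ η_n[∂_ξ Q_{n+1} φ] (ξ_{n+1} - η_n(ξ_{n+1})) + Q_{n+1} φ`,
where `Q_{n+1}` and `∂_ξ Q_{n+1}` are taken at the parameter `η_n(ξ_{n+1})`. -/
def L (S : AdaptiveSMC d E) (n : ℕ) (φ : E (n + 1) → ℝ) (x : E n) : ℝ :=
  (∫ z, S.dQ n (S.theta n) φ z ∂(S.eta n)) (S.stat n x - S.theta n) + S.Q n (S.theta n) φ x

/-- `𝓛_{p,p+k} = 𝓛_{p+1} ∘ ⋯ ∘ 𝓛_{p+k}`, the identity for `k = 0`. -/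
def Lcomp (S : AdaptiveSMC d E) (p : ℕ) : ∀ k, (E (p + k) → ℝ) → (E p → ℝ)
  | 0 => fun φ => φ
  | k + 1 => fun φ => Lcomp S p k (S.L (p + k) φ)

/-- `∑_{p=0}^n Var_{η_p}(𝓛_{p,n} 1) / ∏_{k=p}^{n-1} η_k(G_k)²`. -/
def asympVar (S : AdaptiveSMC d E) (n : ℕ) : ℝ :=
  ∑ p ∈ Finset.range (n + 1),
    Var[S.Lcomp p (n - p) (fun _ => 1); S.eta p] /
      ∏ k ∈ Finset.Ico p n, (∫ x, S.G k (S.theta k) x ∂(S.eta k)) ^ 2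

/-! ### The assumptions -/

/-- Boundedness and uniform continuity at the limiting parameter. -/
def A1 (S : AdaptiveSMC d E) : Prop :=
  ∀ n : ℕ,
    IsBddOn (S.Dom n) (fun x ζ => S.G n ζ x) ∧
    ContinuousAtUniformly (S.Dom n) (fun x ζ => S.G n ζ x) (S.theta n) ∧
    (∃ C : ℝ, ∀ x, ‖S.stat n x‖ ≤ C) ∧
    ∀ φ : E (n + 1) → ℝ, IsBddMeasurable φ →
      IsBddOn (S.Dom n) (fun x ζ => S.Q n ζ φ x) ∧
      ContinuousAtUniformly (S.Dom n) (fun x ζ => S.Q n ζ φ x) (S.theta n)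

/-- Existence, boundedness and uniform continuity at the limiting parameter of `∂_ξ Q_{n+1,ξ} φ`. -/
def A2 (S : AdaptiveSMC d E) : Prop :=
  ∀ n : ℕ, ∀ φ : E (n + 1) → ℝ, IsBddMeasurable φ →
    (∀ x, ∀ ζ ∈ S.Dom n, DifferentiableAt ℝ (fun ζ' => S.Q n ζ' φ x) ζ) ∧
    IsBddOn (S.Dom n) (fun x ζ => S.dQ n ζ φ x) ∧
    ContinuousAtUniformly (S.Dom n) (fun x ζ => S.dQ n ζ φ x) (S.theta n)

/-! ### The practical (adaptive) particle system -/

/-- The empirical measure `(1/N) ∑ δ_{xⁱ}`. -/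
def empirical {X : Type*} [MeasurableSpace X] {N : ℕ} (x : Fin N → X) : Measure X :=
  (N : ℝ≥0∞)⁻¹ • ∑ i, Measure.dirac (x i)

/-- The adapted parameter `η_n^N(ξ_{n+1})`. -/
def thetaN (S : AdaptiveSMC d E) {N : ℕ} (n : ℕ) (x : Fin N → E n) : EuclideanSpace ℝ (Fin d) :=
  ∫ z, S.stat n z ∂(empirical x)

/-- The measure `μ(G_{n,ζ} M_{n+1,ζ})(dy) / μ(G_{n,ζ})` on `E (n + 1)`. -/
def Phi (S : AdaptiveSMC d E) (n : ℕ) (ζ : EuclideanSpace ℝ (Fin d)) (μ : Measure (E n)) :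
    Measure (E (n + 1)) :=
  (∫⁻ x, ENNReal.ofReal (S.G n ζ x) ∂μ)⁻¹ •
    (μ.withDensity (fun x => ENNReal.ofReal (S.G n ζ x))).bind (S.M n ζ)

/-- The joint law of `(x_0^{1:N}, …, x_n^{1:N})`:
`∏_i η_0(dx_0^i) ∏_{p=1}^n ∏_i Φ_{p,N}(η_{p-1}^N)(dx_p^i)`, where `Φ_{p,N}` uses the adapted
parameter `η_{p-1}^N(ξ_p)`. -/
def smcLaw (S : AdaptiveSMC d E) (N : ℕ) : ∀ n, Measure (Hist (fun p => Fin N → E p) n)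
  | 0 => Measure.pi (fun _ : Fin N => S.init)
  | n + 1 =>
    (smcLaw S N n).bind fun h =>
      (Measure.pi fun _ : Fin N =>
        S.Phi n (S.thetaN n (Hist.last h)) (empirical (Hist.last h))).map (Prod.mk h)

/-- `∏_{p=0}^{n-1} η_p^N(G_{p,N})` with `G_{p,N} = G_{p, η_p^N(ξ_{p+1})}`. -/
def prodGN (S : AdaptiveSMC d E) (N : ℕ) : ∀ n, Hist (fun p => Fin N → E p) n → ℝ
  | 0, _ => 1
  | n + 1, h =>
    prodGN S N n h.1 *
      ∫ z, S.G n (S.thetaN n (Hist.last h.1)) z ∂(empirical (Hist.last h.1))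

/-- `γ_n^N(φ) = {∏_{p=0}^{n-1} η_p^N(G_{p,N})} η_n^N(φ)`, as a function of the particles. -/
def gammaN (S : AdaptiveSMC d E) (N n : ℕ) (φ : E n → ℝ)
    (h : Hist (fun p => Fin N → E p) n) : ℝ :=
  S.prodGN N n h * ∫ z, φ z ∂(empirical (Hist.last h))

end

end AdaptiveSMC

/-! Write θ = η_n(ξ_{n+1}), θ^N = η_n^N(ξ_{n+1}) and R = γ_n^N(Q_{n+1,θ^N} φ). Given the particles
up to time n, the mean of γ_{n+1}^N(φ) is exactly R, because the denominator of Φ cancels the last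
factor of the product of potentials (`prodGN_mul_integral_PhiN`). So γ_{n+1}^N(φ) - γ_{n+1}(φ) is a
conditionally centred i.i.d. average plus R - γ_{n+1}(φ).

The second piece linearises. Expand Q_{n+1,θ^N} φ at θ: the first-order term is η_n^N(∂Qφ) applied
to θ^N - θ = η_n^N(ξ_{n+1} - θ), and replacing η_n^N(∂Qφ) by η_n(∂Qφ) costs a product of two terms
of size N^{-1/2}. Hence R = γ_n^N(𝓛φ) + o(N^{-1/2}) in L¹ (`tendsto_sqrt_mul_integral_remainder`),
with rates supplied by the mean-square law of large numbers `meanSquareLLN`. The correction in 𝓛φ is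
η_n-centred, so γ_n(𝓛φ) = γ_{n+1}(φ) (`integral_L_gamma`): what is left is the same problem at time
n for the test function 𝓛φ.

The limit theorem therefore goes by induction on n, for all bounded measurable φ at once, on
characteristic functions. Conditionally on the past, the i.i.d. piece has characteristic function
exp(-t²V_N/2) up to a deterministic O(N^{-1/2}), and V_N tends in L² to γ_{n+1}(1)²
Var_{η_{n+1}}(φ). This limit is a constant, so the Gaussian factor comes out of the expectation and
multiplies the limit for 𝓛φ (`charFunCLT_step_bound`, `charFunCLT_succ`). Unrolling the variance
recursion at φ = 1 and dividing by γ_n(1)² gives the stated sum. -/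

/-! ### Characteristic functions and second moments of sums of bounded i.i.d. variables. -/

/-- Replace the factors one at a time: each swap costs ‖a - b‖, and the other factors lie in the
unit disc. -/
theorem norm_pow_sub_pow_le_of_norm_le_one {a b : ℂ} (ha : ‖a‖ ≤ 1) (hb : ‖b‖ ≤ 1) (n : ℕ) :
    ‖a ^ n - b ^ n‖ ≤ n * ‖a - b‖ := by
  induction n with
  | zero => simp
  | succ n ih =>
    have h : a ^ (n + 1) - b ^ (n + 1) = a ^ n * (a - b) + (a ^ n - b ^ n) * b := by ring
    rw [h]
    refine (norm_add_le _ _).trans ?_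
    rw [norm_mul, norm_mul, norm_pow]
    have h1 : ‖a‖ ^ n ≤ 1 := pow_le_one₀ (norm_nonneg _) ha
    have h2 := norm_nonneg (a - b)
    have h3 := norm_nonneg (a ^ n - b ^ n)
    push_cast
    nlinarith [mul_le_mul_of_nonneg_right h1 h2, mul_le_mul_of_nonneg_left hb h3]

theorem integrable_of_measurable_bdd {Ω : Type*} [MeasurableSpace Ω] {μ : Measure Ω}
    [IsFiniteMeasure μ] {F : Type*} [NormedAddCommGroup F] [MeasurableSpace F] [BorelSpace F]
    [SecondCountableTopology F] {f : Ω → F} (hf : Measurable f) {C : ℝ} (hC : ∀ x, ‖f x‖ ≤ C) :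
    Integrable f μ :=
  Integrable.of_bound hf.aestronglyMeasurable C (Eventually.of_forall hC)

theorem norm_cexp_mul_I_le (x : ℝ) : ‖Complex.exp ((x : ℂ) * Complex.I)‖ ≤ 1 :=
  (Complex.norm_exp_ofReal_mul_I x).le

theorem norm_cexp_sub_cexp_le (x y : ℝ) :
    ‖Complex.exp ((x : ℂ) * Complex.I) - Complex.exp ((y : ℂ) * Complex.I)‖ ≤ |x - y| := by
  have h : Complex.exp ((x : ℂ) * Complex.I) - Complex.exp ((y : ℂ) * Complex.I)
      = Complex.exp ((y : ℂ) * Complex.I) * (Complex.exp (Complex.I * ((x - y : ℝ) : ℂ)) - 1) := by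
    rw [mul_sub, ← Complex.exp_add]
    congr 2
    · push_cast; ring
    · simp
  rw [h, norm_mul, Complex.norm_exp_ofReal_mul_I, one_mul]
  simpa using Real.norm_exp_I_mul_ofReal_sub_one_le (x := x - y)

/-- Second order expansion of the characteristic function of a bounded centred variable. -/
theorem norm_integral_cexp_sub_gaussian_le {X : Type*} [MeasurableSpace X] {ν : Measure X}
    [IsProbabilityMeasure ν] {Y : X → ℝ} (hY : Measurable Y) {B : ℝ} (hB : ∀ x, |Y x| ≤ B)
    (h0 : ∫ x, Y x ∂ν = 0) {s S : ℝ} (hs : |s| ≤ S) :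
    ‖∫ x, Complex.exp (((s * Y x : ℝ) : ℂ) * Complex.I) ∂ν
      - ((Real.exp (-(s ^ 2 * ∫ x, Y x ^ 2 ∂ν) / 2) : ℝ) : ℂ)‖
      ≤ |s| ^ 3 * (B ^ 3 * Real.exp (S * B) + S * B ^ 4 * Real.exp (S ^ 2 * B ^ 2)) := by
  have hne : Nonempty X := nonempty_of_isProbabilityMeasure ν
  have hB0 : 0 ≤ B := (abs_nonneg _).trans (hB hne.some)
  have hS0 : 0 ≤ S := (abs_nonneg _).trans hs
  have iY : Integrable Y ν := integrable_of_measurable_bdd hY hB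
  have iY2 : Integrable (fun x => Y x ^ 2) ν :=
    integrable_of_measurable_bdd (hY.pow_const 2) (C := B ^ 2) fun x => by
      rw [Real.norm_eq_abs, abs_pow]; gcongr; exact hB x
  set v := ∫ x, Y x ^ 2 ∂ν with hv
  have hv0 : 0 ≤ v := integral_nonneg fun x => sq_nonneg _
  have hvB : v ≤ B ^ 2 := by
    have := integral_mono iY2 (integrable_const (B ^ 2)) (fun x => by
      show Y x ^ 2 ≤ B ^ 2
      rw [← sq_abs]; gcongr; exact hB x)
    simpa using this
  let e : X → ℂ := fun x => Complex.exp (((s * Y x : ℝ) : ℂ) * Complex.I)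
  -- Second-order Taylor polynomial of `e`. As `Y` is centred its mean is 1 - s²v/2, which is also
  -- the first-order expansion of the Gaussian factor; the two remainders are bounded separately.
  let p : X → ℂ := fun x => 1 + ((s * Y x : ℝ) : ℂ) * Complex.I - (((s ^ 2 / 2) * Y x ^ 2 : ℝ) : ℂ)
  have hem : Measurable e := by fun_prop
  have ie : Integrable e ν := integrable_of_measurable_bdd hem (fun x => norm_cexp_mul_I_le _)
  have ip1 : Integrable (fun x => ((s * Y x : ℝ) : ℂ) * Complex.I) ν :=
    ((iY.const_mul s).ofReal).mul_const _
  have ip2 : Integrable (fun x => (((s ^ 2 / 2) * Y x ^ 2 : ℝ) : ℂ)) ν :=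
    (iY2.const_mul (s ^ 2 / 2)).ofReal
  have ip : Integrable p ν := ((integrable_const 1).add ip1).sub ip2
  have hpint : ∫ x, p x ∂ν = 1 - ((s ^ 2 * v / 2 : ℝ) : ℂ) := by
    have : ∫ x, p x ∂ν = ∫ x, ((1 : ℂ) + ((s * Y x : ℝ) : ℂ) * Complex.I) ∂ν
        - ∫ x, (((s ^ 2 / 2) * Y x ^ 2 : ℝ) : ℂ) ∂ν :=
      integral_sub ((integrable_const 1).add ip1) ip2
    rw [this, integral_add (integrable_const 1) ip1, integral_mul_const, integral_complex_ofReal,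
      integral_complex_ofReal, integral_const_mul, integral_const_mul, h0, ← hv]
    simp
    ring
  have hd : ‖∫ x, e x ∂ν - ∫ x, p x ∂ν‖ ≤ |s| ^ 3 * (B ^ 3 * Real.exp (S * B)) := by
    rw [← integral_sub ie ip]
    have := norm_integral_le_of_norm_le_const (μ := ν) (f := fun x => e x - p x)
      (C := |s| ^ 3 * (B ^ 3 * Real.exp (S * B))) (Eventually.of_forall fun x => ?_)
    · simpa using this
    · have h3 := Complex.norm_exp_sub_sum_le_norm_mul_exp (((s * Y x : ℝ) : ℂ) * Complex.I) 3
      have hsum : ∑ m ∈ Finset.range 3, (((s * Y x : ℝ) : ℂ) * Complex.I) ^ m / (m.factorial : ℂ)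
          = p x := by
        simp only [Finset.sum_range_succ, Finset.sum_range_zero, p, mul_pow, Complex.I_sq,
          Nat.factorial]
        push_cast
        ring
      rw [hsum] at h3
      refine h3.trans ?_
      have hn : ‖((s * Y x : ℝ) : ℂ) * Complex.I‖ = |s| * |Y x| := by
        rw [norm_mul, Complex.norm_I, mul_one, Complex.norm_real, Real.norm_eq_abs, abs_mul]
      rw [hn, mul_pow, mul_assoc]
      gcongr
      · exact hB x
      · exact hB x
  have hq : ‖(1 - ((s ^ 2 * v / 2 : ℝ) : ℂ)) - ((Real.exp (-(s ^ 2 * v) / 2) : ℝ) : ℂ)‖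
      ≤ |s| ^ 3 * (S * B ^ 4 * Real.exp (S ^ 2 * B ^ 2)) := by
    set x := s ^ 2 * v / 2 with hx
    have hx0 : 0 ≤ x := by positivity
    have h2 := Complex.norm_exp_sub_sum_le_norm_mul_exp ((-x : ℝ) : ℂ) 2
    have hsum : ∑ m ∈ Finset.range 2, ((-x : ℝ) : ℂ) ^ m / (m.factorial : ℂ) = 1 - (x : ℂ) := by
      simp [Finset.sum_range_succ]; ring
    rw [hsum, ← Complex.ofReal_exp] at h2
    rw [norm_sub_rev, show -(s ^ 2 * v) / 2 = -x by rw [hx]; ring]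
    refine h2.trans ?_
    rw [Complex.norm_real, Real.norm_eq_abs, abs_neg, abs_of_nonneg hx0]
    have hs2 : s ^ 2 = |s| ^ 2 := (sq_abs s).symm
    have hxs : x ≤ |s| ^ 2 * B ^ 2 := by
      rw [hx, hs2]; nlinarith [mul_le_mul_of_nonneg_left hvB (sq_nonneg |s|),
        mul_nonneg (sq_nonneg |s|) hv0]
    have hxS : x ≤ S ^ 2 * B ^ 2 := hxs.trans (by gcongr)
    -- This remainder is of order four in s; one factor |s| is bounded by `S`, so that both
    -- remainders carry |s|³.
    calc x ^ 2 * Real.exp x ≤ (|s| ^ 2 * B ^ 2) ^ 2 * Real.exp (S ^ 2 * B ^ 2) := by gcongr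
      _ = |s| ^ 3 * (|s| * B ^ 4 * Real.exp (S ^ 2 * B ^ 2)) := by ring
      _ ≤ _ := by gcongr
  have : ∫ x, e x ∂ν - ((Real.exp (-(s ^ 2 * v) / 2) : ℝ) : ℂ)
      = (∫ x, e x ∂ν - ∫ x, p x ∂ν)
        + ((1 - ((s ^ 2 * v / 2 : ℝ) : ℂ)) - ((Real.exp (-(s ^ 2 * v) / 2) : ℝ) : ℂ)) := by
    rw [hpint]; ring
  show ‖∫ x, e x ∂ν - _‖ ≤ _
  rw [this, mul_add]
  exact (norm_add_le _ _).trans (add_le_add hd hq)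

/-- Quantitative central limit theorem for the characteristic function of a sum of bounded centred
i.i.d. variables. -/
theorem norm_integral_pi_cexp_sub_gaussian_le {X : Type*} [MeasurableSpace X] {ν : Measure X}
    [IsProbabilityMeasure ν] {Y : X → ℝ} (hY : Measurable Y) {B : ℝ} (hB : ∀ x, |Y x| ≤ B)
    (h0 : ∫ x, Y x ∂ν = 0) {N : ℕ} {s S : ℝ} (hs : |s| ≤ S) :
    ‖∫ x : Fin N → X, Complex.exp (((s * ∑ i, Y (x i) : ℝ) : ℂ) * Complex.I)
        ∂(Measure.pi fun _ => ν)
      - ((Real.exp (-(N * s ^ 2 * ∫ x, Y x ^ 2 ∂ν) / 2) : ℝ) : ℂ)‖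
      ≤ N * (|s| ^ 3 * (B ^ 3 * Real.exp (S * B) + S * B ^ 4 * Real.exp (S ^ 2 * B ^ 2))) := by
  have h1 : ∫ x : Fin N → X, Complex.exp (((s * ∑ i, Y (x i) : ℝ) : ℂ) * Complex.I)
        ∂(Measure.pi fun _ => ν)
      = (∫ x, Complex.exp (((s * Y x : ℝ) : ℂ) * Complex.I) ∂ν) ^ N := by
    have := integral_fintype_prod_eq_prod (𝕜 := ℂ) (ι := Fin N) (E := fun _ => X)
      (f := fun _ x => Complex.exp (((s * Y x : ℝ) : ℂ) * Complex.I)) (μ := fun _ => ν)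
    rw [Finset.prod_const, Finset.card_univ, Fintype.card_fin] at this
    rw [← this]
    congr 1 with x
    rw [← Complex.exp_sum, ← Finset.sum_mul, Finset.mul_sum]
    push_cast
    rfl
  have h2 : Real.exp (-(N * s ^ 2 * ∫ x, Y x ^ 2 ∂ν) / 2)
      = Real.exp (-(s ^ 2 * ∫ x, Y x ^ 2 ∂ν) / 2) ^ N := by
    rw [← Real.exp_nat_mul]; congr 1; ring
  rw [h1, h2, Complex.ofReal_pow]
  -- The one-variable error |s|³ is only multiplied by N; for s of order N^{-1/2} this leaves
  -- N^{-1/2}.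
  refine (norm_pow_sub_pow_le_of_norm_le_one ?_ ?_ N).trans ?_
  · have := norm_integral_le_of_norm_le_const (μ := ν)
      (f := fun x => Complex.exp (((s * Y x : ℝ) : ℂ) * Complex.I)) (C := 1)
      (Eventually.of_forall fun x => norm_cexp_mul_I_le _)
    simpa using this
  · rw [Complex.norm_real, Real.norm_eq_abs, Real.abs_exp, Real.exp_le_one_iff]
    have : 0 ≤ ∫ x, Y x ^ 2 ∂ν := integral_nonneg fun x => sq_nonneg _
    have : 0 ≤ s ^ 2 * ∫ x, Y x ^ 2 ∂ν := by positivity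
    linarith
  · gcongr
    exact norm_integral_cexp_sub_gaussian_le hY hB h0 hs

/-- The mean square of the average of bounded centred i.i.d. variables. -/
theorem integral_pi_sq_average_le {X : Type*} [MeasurableSpace X] {ν : Measure X}
    [IsProbabilityMeasure ν] {Y : X → ℝ} (hY : Measurable Y) {B : ℝ} (hB : ∀ x, |Y x| ≤ B)
    (h0 : ∫ x, Y x ∂ν = 0) {N : ℕ} (hN : 0 < N) :
    ∫ x : Fin N → X, ((N : ℝ)⁻¹ * ∑ i, Y (x i)) ^ 2 ∂(Measure.pi fun _ => ν) ≤ B ^ 2 / N := by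
  have hN' : (0 : ℝ) < N := by exact_mod_cast hN
  have mY : MemLp Y 2 ν := MemLp.of_bound hY.aestronglyMeasurable B (Eventually.of_forall hB)
  have hvar := variance_sum_pi (ι := Fin N) (Ω := fun _ => X) (μ := fun _ => ν) (X := fun _ => Y)
    (fun _ => mY)
  have hmi : ∀ i : Fin N, ∫ x : Fin N → X, Y (x i) ∂(Measure.pi fun _ => ν) = 0 := fun i => by
    rw [integral_comp_eval (μ := fun _ : Fin N => ν) (f := Y) hY.aestronglyMeasurable, h0]
  have hm0 : ∫ x : Fin N → X, (∑ i, fun x : Fin N → X => Y (x i)) x ∂(Measure.pi fun _ => ν) = 0 := by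
    simp only [Finset.sum_apply]
    rw [integral_finsetSum]
    · simp [hmi]
    · intro i _
      exact integrable_of_measurable_bdd (hY.comp (measurable_pi_apply i)) (fun x => hB (x i))
  rw [variance_of_integral_eq_zero (by fun_prop) hm0] at hvar
  have hv : Var[Y; ν] ≤ B ^ 2 := by
    rw [variance_of_integral_eq_zero hY.aemeasurable h0]
    have := integral_mono (μ := ν) (f := fun x => Y x ^ 2) (g := fun _ => B ^ 2) mY.integrable_sq
      (integrable_const (B ^ 2)) (fun x => by
      show Y x ^ 2 ≤ B ^ 2
      rw [← sq_abs]; gcongr; exact hB x)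
    simpa using this
  simp only [Finset.sum_apply, Finset.sum_const, Finset.card_univ, Fintype.card_fin,
    nsmul_eq_mul] at hvar
  simp only [mul_pow]
  rw [integral_const_mul, hvar]
  calc ((N : ℝ)⁻¹) ^ 2 * (N * Var[Y; ν]) = Var[Y; ν] / N := by field_simp
    _ ≤ _ := by gcongr

/-! ### Empirical measures and the one-step operators Q and Φ. -/

namespace AdaptiveSMC

variable {d : ℕ} {E : ℕ → Type*} [∀ n, MeasurableSpace (E n)]

instance (S : AdaptiveSMC d E) (n : ℕ) (ζ : EuclideanSpace ℝ (Fin d)) :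
    IsMarkovKernel (S.M n ζ) := S.M_markov n ζ

instance (S : AdaptiveSMC d E) : IsProbabilityMeasure S.init := S.init_prob

theorem lintegral_empirical {X : Type*} [MeasurableSpace X] {N : ℕ} (x : Fin N → X)
    {f : X → ℝ≥0∞} (hf : Measurable f) :
    ∫⁻ z, f z ∂(empirical x) = (N : ℝ≥0∞)⁻¹ * ∑ i, f (x i) := by
  rw [empirical, lintegral_smul_measure, lintegral_finsetSum_measure]
  simp [lintegral_dirac' _ hf]

theorem integral_empirical {X : Type*} [MeasurableSpace X] {N : ℕ} (x : Fin N → X)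
    {F : Type*} [NormedAddCommGroup F] [NormedSpace ℝ F] [CompleteSpace F]
    {f : X → F} (hf : StronglyMeasurable f) :
    ∫ z, f z ∂(empirical x) = (N : ℝ)⁻¹ • ∑ i, f (x i) := by
  rw [empirical, integral_smul_measure, integral_finsetSum_measure]
  · simp [integral_dirac' _ _ hf]
  · intro i _
    exact integrable_dirac' hf (by simp)

theorem isProbabilityMeasure_empirical {X : Type*} [MeasurableSpace X] {N : ℕ} (hN : 0 < N)
    (x : Fin N → X) : IsProbabilityMeasure (empirical x) := by
  constructor
  rw [← lintegral_one, lintegral_empirical x measurable_const]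
  simp only [Finset.sum_const, Finset.card_univ, Fintype.card_fin, nsmul_eq_mul, mul_one]
  exact ENNReal.inv_mul_cancel (by exact_mod_cast hN.ne') (by simp)

theorem Q_one (S : AdaptiveSMC d E) (n : ℕ) (ζ : EuclideanSpace ℝ (Fin d)) (x : E n) :
    S.Q n ζ (fun _ => 1) x = S.G n ζ x := by
  simp [Q]

theorem measurable_Q (S : AdaptiveSMC d E) (n : ℕ) (ζ : EuclideanSpace ℝ (Fin d))
    {φ : E (n + 1) → ℝ} (hφ : Measurable φ) : Measurable (S.Q n ζ φ) :=
  (S.G_meas n ζ).mul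
    (StronglyMeasurable.integral_kernel (κ := S.M n ζ) hφ.stronglyMeasurable).measurable

/-- The measure `μ(G_{n,ζ} M_{n+1,ζ})`. -/
noncomputable def push (S : AdaptiveSMC d E) (n : ℕ) (ζ : EuclideanSpace ℝ (Fin d))
    (μ : Measure (E n)) : Measure (E (n + 1)) :=
  (μ.withDensity (fun x => ENNReal.ofReal (S.G n ζ x))).bind (S.M n ζ)

theorem push_apply (S : AdaptiveSMC d E) (n : ℕ) (ζ : EuclideanSpace ℝ (Fin d))
    (μ : Measure (E n)) {A : Set (E (n + 1))} (hA : MeasurableSet A) :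
    S.push n ζ μ A = ∫⁻ x, ENNReal.ofReal (S.G n ζ x) * S.M n ζ x A ∂μ := by
  rw [push, Measure.bind_apply hA (S.M n ζ).aemeasurable,
    lintegral_withDensity_eq_lintegral_mul _ (S.G_meas n ζ).ennreal_ofReal
      ((S.M n ζ).measurable_coe hA)]
  rfl

theorem push_univ (S : AdaptiveSMC d E) (n : ℕ) (ζ : EuclideanSpace ℝ (Fin d))
    (μ : Measure (E n)) :
    S.push n ζ μ Set.univ = ∫⁻ x, ENNReal.ofReal (S.G n ζ x) ∂μ := by
  rw [push_apply _ _ _ _ MeasurableSet.univ]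
  simp

theorem integral_push (S : AdaptiveSMC d E) (n : ℕ) (ζ : EuclideanSpace ℝ (Fin d))
    (μ : Measure (E n)) [IsFiniteMeasure μ] {C : ℝ} (hC : ∀ x, |S.G n ζ x| ≤ C)
    {φ : E (n + 1) → ℝ} (hφ : IsBddMeasurable φ) :
    ∫ y, φ y ∂(S.push n ζ μ) = ∫ x, S.Q n ζ φ x ∂μ := by
  obtain ⟨hm, K, hK⟩ := hφ
  have iG : Integrable (S.G n ζ) μ := integrable_of_measurable_bdd (S.G_meas n ζ) hC
  have : IsFiniteMeasure (μ.withDensity (fun x => ENNReal.ofReal (S.G n ζ x))) :=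
    isFiniteMeasure_withDensity_ofReal iG.2
  rw [push, ← Measure.snd_compProd, Measure.snd,
    integral_map measurable_snd.aemeasurable hm.aestronglyMeasurable,
    Measure.integral_compProd (f := fun p : E n × E (n + 1) => φ p.2) (integrable_of_measurable_bdd (hm.comp measurable_snd)
      (fun p => hK p.2)),
    integral_withDensity_eq_integral_toReal_smul (S.G_meas n ζ).ennreal_ofReal (by simp)]
  congr 1 with x
  rw [ENNReal.toReal_ofReal (S.G_pos n ζ x).le, Q, smul_eq_mul]

theorem Phi_eq (S : AdaptiveSMC d E) (n : ℕ) (ζ : EuclideanSpace ℝ (Fin d))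
    (μ : Measure (E n)) :
    S.Phi n ζ μ = (∫⁻ x, ENNReal.ofReal (S.G n ζ x) ∂μ)⁻¹ • S.push n ζ μ := rfl

theorem lintegral_G_pos (S : AdaptiveSMC d E) (n : ℕ) (ζ : EuclideanSpace ℝ (Fin d))
    (μ : Measure (E n)) (hμ : μ ≠ 0) : ∫⁻ x, ENNReal.ofReal (S.G n ζ x) ∂μ ≠ 0 := by
  rw [Ne, lintegral_eq_zero_iff (S.G_meas n ζ).ennreal_ofReal]
  intro h
  apply hμ
  rw [← Measure.measure_univ_eq_zero]
  refine measure_mono_null (fun x _ => ?_) h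
  have := S.G_pos n ζ x
  simp [this]

theorem integral_G_pos (S : AdaptiveSMC d E) (n : ℕ) (ζ : EuclideanSpace ℝ (Fin d))
    (μ : Measure (E n)) [IsFiniteMeasure μ] (hμ : μ ≠ 0) {C : ℝ} (hC : ∀ x, |S.G n ζ x| ≤ C) :
    0 < ∫ x, S.G n ζ x ∂μ := by
  rw [integral_eq_lintegral_of_nonneg_ae (Eventually.of_forall fun x => (S.G_pos n ζ x).le)
    (S.G_meas n ζ).aestronglyMeasurable]
  refine ENNReal.toReal_pos (S.lintegral_G_pos n ζ μ hμ) ?_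
  have iG : Integrable (S.G n ζ) μ := integrable_of_measurable_bdd (S.G_meas n ζ) hC
  exact iG.lintegral_lt_top.ne

theorem isProbabilityMeasure_Phi (S : AdaptiveSMC d E) (n : ℕ) (ζ : EuclideanSpace ℝ (Fin d))
    (μ : Measure (E n)) [IsFiniteMeasure μ] (hμ : μ ≠ 0) {C : ℝ} (hC : ∀ x, |S.G n ζ x| ≤ C) :
    IsProbabilityMeasure (S.Phi n ζ μ) := by
  have iG : Integrable (S.G n ζ) μ := integrable_of_measurable_bdd (S.G_meas n ζ) hC
  constructor
  rw [Phi_eq, Measure.smul_apply, push_univ, smul_eq_mul]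
  exact ENNReal.inv_mul_cancel (S.lintegral_G_pos n ζ μ hμ) iG.lintegral_lt_top.ne

theorem integral_Phi (S : AdaptiveSMC d E) (n : ℕ) (ζ : EuclideanSpace ℝ (Fin d))
    (μ : Measure (E n)) [IsFiniteMeasure μ] {C : ℝ} (hC : ∀ x, |S.G n ζ x| ≤ C)
    {φ : E (n + 1) → ℝ} (hφ : IsBddMeasurable φ) :
    ∫ y, φ y ∂(S.Phi n ζ μ) = (∫ x, S.G n ζ x ∂μ)⁻¹ * ∫ x, S.Q n ζ φ x ∂μ := by
  rw [Phi_eq, integral_smul_measure, S.integral_push n ζ μ hC hφ, ENNReal.toReal_inv,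
    integral_eq_lintegral_of_nonneg_ae (Eventually.of_forall fun x => (S.G_pos n ζ x).le)
    (S.G_meas n ζ).aestronglyMeasurable, smul_eq_mul]

/-! ### The limiting flow -/

theorem feynmanKac_regular (S : AdaptiveSMC d E) (n : ℕ) :
    IsProbabilityMeasure (S.feynmanKac n).1 ∧ Measurable (S.feynmanKac n).2 := by
  induction n with
  | zero => exact ⟨S.init_prob, measurable_const⟩
  | succ n ih =>
    obtain ⟨h1, h2⟩ := ih
    rw [feynmanKac_succ]
    refine ⟨inferInstanceAs (IsProbabilityMeasure ((S.feynmanKac n).1 ⊗ₘ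
      ((S.M n (S.theta n)).comap Hist.last Hist.measurable_last))), ?_⟩
    have hfst : Measurable (Prod.fst : Hist E n × E (n + 1) → Hist E n) := measurable_fst
    exact (h2.comp hfst).mul
      (((S.G_meas n (S.theta n)).comp (Hist.measurable_last.comp hfst)).ennreal_ofReal)

theorem gamma_zero (S : AdaptiveSMC d E) : S.gamma 0 = S.init := by
  show (S.init.withDensity (fun _ => 1)).map id = S.init
  rw [Measure.map_id]
  exact withDensity_one

/-- The new weight depends on the path only through Xₙ, and integrating out the last point leaves
the kernel at Xₙ. This reduces the path-space definition to a one-step recursion, the only form used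
afterwards. -/
theorem gamma_succ (S : AdaptiveSMC d E) (n : ℕ) :
    S.gamma (n + 1) = S.push n (S.theta n) (S.gamma n) := by
  obtain ⟨h1, h2⟩ := S.feynmanKac_regular n
  ext A hA
  rw [push_apply _ _ _ _ hA, gamma, terminal, gamma, terminal]
  have hg : Measurable fun x => ENNReal.ofReal (S.G n (S.theta n) x) * S.M n (S.theta n) x A :=
    (S.G_meas n (S.theta n)).ennreal_ofReal.mul ((S.M n (S.theta n)).measurable_coe hA)
  have hd : ∫⁻ a, ENNReal.ofReal (S.G n (S.theta n) a.last) * S.M n (S.theta n) a.last A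
      ∂((S.feynmanKac n).1.withDensity (S.feynmanKac n).2) = ∫⁻ a, (S.feynmanKac n).2 a *
        (ENNReal.ofReal (S.G n (S.theta n) a.last) * S.M n (S.theta n) a.last A)
        ∂(S.feynmanKac n).1 :=
    lintegral_withDensity_eq_lintegral_mul _ h2 (hg.comp Hist.measurable_last)
  rw [lintegral_map hg Hist.measurable_last, hd,
    Measure.map_apply Hist.measurable_last hA, feynmanKac_succ,
    withDensity_apply _ (Hist.measurable_last hA), ← lintegral_indicator
      (Hist.measurable_last hA)]
  have hm : Measurable (fun h : Hist E n × E (n + 1) =>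
      A.indicator (fun _ => (S.feynmanKac n).2 h.1 *
        ENNReal.ofReal (S.G n (S.theta n) (Hist.last h.1))) h.2) := by
    have : Measurable (fun h : Hist E n × E (n + 1) => (S.feynmanKac n).2 h.1 *
        ENNReal.ofReal (S.G n (S.theta n) (Hist.last h.1))) :=
      (h2.comp measurable_fst).mul
      (((S.G_meas n (S.theta n)).comp (Hist.measurable_last.comp measurable_fst)).ennreal_ofReal)
    exact this.indicator (measurable_snd hA)
  refine (Measure.lintegral_compProd hm).trans ?_
  refine lintegral_congr fun h => ?_
  refine (lintegral_indicator_const hA ((S.feynmanKac n).2 h *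
    ENNReal.ofReal (S.G n (S.theta n) h.last))).trans ?_
  simp [Kernel.comap_apply, mul_assoc]

end AdaptiveSMC

/-! ### Taylor estimates at a parameter in the closure of the domain. -/

theorem mem_nhdsWithin_ball_of_dist {V : Type*} [PseudoMetricSpace V] {D : Set V} {θ : V} {δ : ℝ}
    (hδ : 0 < δ) : ∀ᶠ z in 𝓝[D] θ, z ∈ D ∧ dist z θ < δ :=
  (eventually_mem_nhdsWithin).and (mem_nhdsWithin_of_mem_nhds (Metric.ball_mem_nhds θ hδ))

theorem ContinuousAtUniformly.tendsto {X Y Z : Type*} [PseudoMetricSpace Y] [PseudoMetricSpace Z]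
    {D : Set Y} {f : X → Y → Z} {y₀ : Y} (h : ContinuousAtUniformly D f y₀) (x : X) :
    Tendsto (f x) (𝓝[D] y₀) (𝓝 (f x y₀)) := by
  rw [Metric.tendsto_nhds]
  intro ε hε
  obtain ⟨δ, hδ, H⟩ := h ε hε
  filter_upwards [mem_nhdsWithin_ball_of_dist (D := D) (θ := y₀) hδ] with z hz
  exact H x z hz.1 hz.2

/-- The limiting parameter is only known to lie in the closure of `Dom`, so bounds on `Dom` reach it
by passing to the limit. -/
theorem IsBddOn.bound_at {X Y Z : Type*} [PseudoMetricSpace Y] [SeminormedAddCommGroup Z]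
    {D : Set Y} {f : X → Y → Z} {y₀ : Y} (h : ContinuousAtUniformly D f y₀)
    (hy : y₀ ∈ closure D) {C : ℝ} (hC : ∀ x, ∀ y ∈ D, ‖f x y‖ ≤ C) (x : X) : ‖f x y₀‖ ≤ C := by
  have : (𝓝[D] y₀).NeBot := mem_closure_iff_nhdsWithin_neBot.1 hy
  refine le_of_tendsto (h.tendsto x).norm ?_
  filter_upwards [eventually_mem_nhdsWithin] with z hz using hC x z hz

/-- The mean value inequality on the convex set D ∩ ball bounds the increment from z to ζ, and z is
then sent to θ inside D. No differentiability at θ itself is needed. -/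
theorem norm_sub_sub_le_of_fderiv_near {V : Type*} [NormedAddCommGroup V] [NormedSpace ℝ V]
    {D : Set V} (hD : Convex ℝ D) {θ : V} (hθ : θ ∈ closure D) {f : V → ℝ}
    (hf : ∀ z ∈ D, DifferentiableAt ℝ f z) (hc : Tendsto f (𝓝[D] θ) (𝓝 (f θ)))
    {A : V →L[ℝ] ℝ} {ε δ : ℝ} (hA : ∀ z ∈ D, dist z θ < δ → ‖fderiv ℝ f z - A‖ ≤ ε)
    {ζ : V} (hζ : ζ ∈ D) (hζδ : dist ζ θ < δ) :
    |f ζ - f θ - A (ζ - θ)| ≤ ε * ‖ζ - θ‖ := by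
  have : (𝓝[D] θ).NeBot := mem_closure_iff_nhdsWithin_neBot.1 hθ
  have hconv : Convex ℝ (D ∩ Metric.ball θ δ) := hD.inter (convex_ball θ δ)
  have key : ∀ z ∈ D ∩ Metric.ball θ δ, ‖f ζ - f z - A (ζ - z)‖ ≤ ε * ‖ζ - z‖ := fun z hz =>
    hconv.norm_image_sub_le_of_norm_fderiv_le' (f := f) (φ := A)
      (fun w hw => hf w hw.1) (fun w hw => hA w hw.1 hw.2) hz ⟨hζ, hζδ⟩
  have hid : Tendsto (fun z : V => z) (𝓝[D] θ) (𝓝 θ) := tendsto_id.mono_left nhdsWithin_le_nhds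
  have hsub : Tendsto (fun z : V => ζ - z) (𝓝[D] θ) (𝓝 (ζ - θ)) := tendsto_const_nhds.sub hid
  refine le_of_tendsto_of_tendsto
    (((tendsto_const_nhds.sub hc).sub ((A.continuous.tendsto _).comp hsub)).norm)
    (hsub.norm.const_mul ε) ?_
  filter_upwards [mem_nhdsWithin_ball_of_dist (D := D) (θ := θ)
    (lt_of_le_of_lt dist_nonneg hζδ)] with z hz using key z hz

namespace AdaptiveSMC

variable {d : ℕ} {E : ℕ → Type*} [∀ n, MeasurableSpace (E n)]

theorem isBddMeasurable_const {X : Type*} [MeasurableSpace X] (c : ℝ) :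
    IsBddMeasurable (fun _ : X => c) := ⟨measurable_const, |c|, fun _ => le_rfl⟩

theorem measurable_stat_apply (S : AdaptiveSMC d E) (n : ℕ) (j : Fin d) :
    Measurable (fun x => S.stat n x j) := by
  have := S.stat_meas n
  fun_prop

theorem abs_apply_le_norm (v : EuclideanSpace ℝ (Fin d)) (j : Fin d) : |v j| ≤ ‖v‖ :=
  PiLp.norm_apply_le v j

theorem norm_le_sum_abs (v : EuclideanSpace ℝ (Fin d)) : ‖v‖ ≤ ∑ j, |v j| := by
  have h := (EuclideanSpace.basisFun (Fin d) ℝ).sum_repr v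
  calc ‖v‖ = ‖∑ i, (EuclideanSpace.basisFun (Fin d) ℝ).repr v i •
      (EuclideanSpace.basisFun (Fin d) ℝ) i‖ := by rw [h]
    _ ≤ ∑ i, ‖(EuclideanSpace.basisFun (Fin d) ℝ).repr v i •
      (EuclideanSpace.basisFun (Fin d) ℝ) i‖ := norm_sum_le _ _
    _ = _ := by simp [norm_smul]

theorem clm_apply_eq_sum (A : EuclideanSpace ℝ (Fin d) →L[ℝ] ℝ) (v : EuclideanSpace ℝ (Fin d)) :
    A v = ∑ j, v j * A (EuclideanSpace.basisFun (Fin d) ℝ j) := by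
  have h := (EuclideanSpace.basisFun (Fin d) ℝ).sum_repr v
  conv_lhs => rw [← h]
  simp

theorem measurable_clm_of_apply {X : Type*} [MeasurableSpace X]
    {f : X → EuclideanSpace ℝ (Fin d) →L[ℝ] ℝ} (hf : ∀ v, Measurable fun x => f x v) :
    Measurable f := by
  have : f = fun x => ∑ j, f x (EuclideanSpace.basisFun (Fin d) ℝ j) •
      (EuclideanSpace.proj j : EuclideanSpace ℝ (Fin d) →L[ℝ] ℝ) := by
    ext1 x
    ext v
    rw [clm_apply_eq_sum]
    simp [mul_comm]
  rw [this]
  exact Finset.measurable_sum _ fun j _ => (hf _).smul_const _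

/-- A directional derivative is a pointwise limit of difference quotients. The points ζ + v/k may
leave `Dom`, which is harmless: Q is measurable in x for every parameter. -/
theorem measurable_dQ_apply (S : AdaptiveSMC d E) (hA2 : S.A2) (n : ℕ)
    {ζ : EuclideanSpace ℝ (Fin d)} (hζ : ζ ∈ S.Dom n)
    {φ : E (n + 1) → ℝ} (hφ : IsBddMeasurable φ) (v : EuclideanSpace ℝ (Fin d)) :
    Measurable fun x => S.dQ n ζ φ x v := by
  have hlim : Tendsto (fun k : ℕ => ‖(k : ℝ)‖) atTop atTop := by
    simpa using tendsto_natCast_atTop_atTop (R := ℝ)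
  refine measurable_of_tendsto_metrizable (f := fun (k : ℕ) x =>
    (k : ℝ) • (S.Q n (ζ + (k : ℝ)⁻¹ • v) φ x - S.Q n ζ φ x)) (fun k => ?_) ?_
  · exact ((S.measurable_Q n _ hφ.1).sub (S.measurable_Q n _ hφ.1)).const_mul (k : ℝ)
  · rw [tendsto_pi_nhds]
    intro x
    exact (((hA2 n φ hφ).1 x ζ hζ).hasFDerivAt).lim v hlim

/-- Differentiability is assumed only on `Dom`, so θ is approached by points of `Dom` and the
continuity in (A2) transfers measurability. -/
theorem measurable_dQ_theta (S : AdaptiveSMC d E) (hA2 : S.A2) (n : ℕ)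
    (hθ : S.theta n ∈ closure (S.Dom n))
    {φ : E (n + 1) → ℝ} (hφ : IsBddMeasurable φ) :
    Measurable (S.dQ n (S.theta n) φ) := by
  have hne : (𝓝[S.Dom n] S.theta n).NeBot := mem_closure_iff_nhdsWithin_neBot.1 hθ
  obtain ⟨u, hu, hlim⟩ := mem_closure_iff_seq_limit.1 hθ
  have hlim' : Tendsto u atTop (𝓝[S.Dom n] S.theta n) :=
    tendsto_nhdsWithin_iff.2 ⟨hlim, Eventually.of_forall hu⟩
  refine measurable_of_tendsto_metrizable (f := fun (k : ℕ) x => S.dQ n (u k) φ x)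
    (fun k => measurable_clm_of_apply (S.measurable_dQ_apply hA2 n (hu k) hφ)) ?_
  rw [tendsto_pi_nhds]
  intro x
  exact ((hA2 n φ hφ).2.2.tendsto x).comp hlim'

theorem exists_norm_dQ_le (S : AdaptiveSMC d E) (hA2 : S.A2) (n : ℕ)
    (hθ : S.theta n ∈ closure (S.Dom n))
    {φ : E (n + 1) → ℝ} (hφ : IsBddMeasurable φ) :
    ∃ C, 0 ≤ C ∧ (∀ x, ∀ ζ ∈ S.Dom n, ‖S.dQ n ζ φ x‖ ≤ C) ∧
      ∀ x, ‖S.dQ n (S.theta n) φ x‖ ≤ C := by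
  obtain ⟨C, hC⟩ := (hA2 n φ hφ).2.1
  refine ⟨|C|, abs_nonneg C, fun x ζ hζ => (hC x ζ hζ).trans (le_abs_self C), fun x => ?_⟩
  exact (IsBddOn.bound_at (hA2 n φ hφ).2.2 hθ hC x).trans (le_abs_self C)

theorem exists_abs_Q_sub_le (S : AdaptiveSMC d E) (hA1 : S.A1) (hA2 : S.A2) (n : ℕ)
    (hθ : S.theta n ∈ closure (S.Dom n))
    {φ : E (n + 1) → ℝ} (hφ : IsBddMeasurable φ) :
    ∃ C, 0 ≤ C ∧ ∀ x, ∀ ζ ∈ S.Dom n,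
      |S.Q n ζ φ x - S.Q n (S.theta n) φ x| ≤ C * ‖ζ - S.theta n‖ := by
  obtain ⟨C, hC0, hC, -⟩ := S.exists_norm_dQ_le hA2 n hθ hφ
  refine ⟨C, hC0, fun x ζ hζ => ?_⟩
  -- With A = 0 the estimate becomes a Lipschitz bound; the radius is just large enough to contain
  -- ζ.
  have := norm_sub_sub_le_of_fderiv_near (S.Dom_convex n) hθ (f := fun ζ' => S.Q n ζ' φ x)
    ((hA2 n φ hφ).1 x) (((hA1 n).2.2.2 φ hφ).2.tendsto x) (A := 0) (ε := C)
    (δ := dist ζ (S.theta n) + 1) (fun z hz _ => by simpa using! hC x z hz) hζ (by linarith)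
  simpa using this

/-- Within distance δ of θ, continuity of the derivative gives ε‖ζ - θ‖. Beyond δ, the crude linear
bound is quadratic after division by δ. The resulting bound holds on all of `Dom`, so no exceptional
event has to be treated later. -/
theorem exists_abs_Q_sub_sub_le (S : AdaptiveSMC d E) (hA1 : S.A1) (hA2 : S.A2) (n : ℕ)
    (hθ : S.theta n ∈ closure (S.Dom n))
    {φ : E (n + 1) → ℝ} (hφ : IsBddMeasurable φ) {ε : ℝ} (hε : 0 < ε) :
    ∃ K, 0 ≤ K ∧ ∀ x, ∀ ζ ∈ S.Dom n,
      |S.Q n ζ φ x - S.Q n (S.theta n) φ x - S.dQ n (S.theta n) φ x (ζ - S.theta n)|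
        ≤ (ε + K * ‖ζ - S.theta n‖) * ‖ζ - S.theta n‖ := by
  obtain ⟨C, hC0, -, hC⟩ := S.exists_norm_dQ_le hA2 n hθ hφ
  obtain ⟨C', hC0', hC'⟩ := S.exists_abs_Q_sub_le hA1 hA2 n hθ hφ
  obtain ⟨δ, hδ, H⟩ := (hA2 n φ hφ).2.2 ε hε
  refine ⟨(C + C') / δ, by positivity, fun x ζ hζ => ?_⟩
  have hr0 := norm_nonneg (ζ - S.theta n)
  rcases lt_or_ge (dist ζ (S.theta n)) δ with hlt | hge
  · have := norm_sub_sub_le_of_fderiv_near (S.Dom_convex n) hθ (f := fun ζ' => S.Q n ζ' φ x)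
      ((hA2 n φ hφ).1 x) (((hA1 n).2.2.2 φ hφ).2.tendsto x) (A := S.dQ n (S.theta n) φ x) (ε := ε)
      (δ := δ) (fun z hz hzδ => by
        have := (H x z hz hzδ).le
        rwa [dist_eq_norm] at this) hζ hlt
    refine this.trans ?_
    gcongr
    have : 0 ≤ (C + C') / δ * ‖ζ - S.theta n‖ := by positivity
    linarith
  · rw [dist_eq_norm] at hge
    have h1 := hC' x ζ hζ
    have h2 : |S.dQ n (S.theta n) φ x (ζ - S.theta n)| ≤ C * ‖ζ - S.theta n‖ :=
      (S.dQ n (S.theta n) φ x).le_of_opNorm_le (hC x) _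
    have h3 := abs_sub (S.Q n ζ φ x - S.Q n (S.theta n) φ x)
      (S.dQ n (S.theta n) φ x (ζ - S.theta n))
    have h4 : (C + C') * ‖ζ - S.theta n‖ ≤ (C + C') / δ * ‖ζ - S.theta n‖ * ‖ζ - S.theta n‖ := by
      gcongr
      rw [div_mul_eq_mul_div, le_div_iff₀ hδ]
      gcongr
    nlinarith

/-! ### Regularity of the limiting flow -/

theorem isProbabilityMeasure_eta_of (S : AdaptiveSMC d E) (n : ℕ)
    (h : IsFiniteMeasure (S.gamma n) ∧ S.gamma n ≠ 0) : IsProbabilityMeasure (S.eta n) := by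
  constructor
  rw [eta, normalise, Measure.smul_apply, smul_eq_mul]
  have := h.1
  exact ENNReal.inv_mul_cancel (by simpa using h.2) (measure_ne_top _ _)

/-- The mean of a random point of a convex set lies in its closure; `Dom` is not assumed closed. -/
theorem theta_mem_closure_of (S : AdaptiveSMC d E) (hA1 : S.A1) (n : ℕ)
    [IsProbabilityMeasure (S.eta n)] : S.theta n ∈ closure (S.Dom n) := by
  obtain ⟨C, hC⟩ := (hA1 n).2.2.1
  exact (S.Dom_convex n).closure.integral_mem isClosed_closure
    (Eventually.of_forall fun x => subset_closure (S.stat_mem n x))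
    (integrable_of_measurable_bdd (S.stat_meas n) hC)

theorem exists_G_le_of (S : AdaptiveSMC d E) (hA1 : S.A1) (n : ℕ)
    (hθ : S.theta n ∈ closure (S.Dom n)) :
    ∃ C, 1 ≤ C ∧ (∀ x, ∀ ζ ∈ S.Dom n, |S.G n ζ x| ≤ C) ∧ ∀ x, |S.G n (S.theta n) x| ≤ C := by
  obtain ⟨C, hC⟩ := (hA1 n).1
  refine ⟨max C 1, le_max_right _ _, fun x ζ hζ => (hC x ζ hζ).trans (le_max_left _ _),
    fun x => ?_⟩
  exact (IsBddOn.bound_at (hA1 n).2.1 hθ hC x).trans (le_max_left _ _)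

/-- The facts are interlocked: γ_n finite and nonzero makes η_n a probability, which puts θ in the
closure of `Dom`, which bounds G at θ, which makes γ_{n+1} finite. Hence the preliminary `_of`
versions, which take the earlier facts as hypotheses. -/
theorem gamma_regular (S : AdaptiveSMC d E) (hA1 : S.A1) (n : ℕ) :
    IsFiniteMeasure (S.gamma n) ∧ S.gamma n ≠ 0 := by
  induction n with
  | zero =>
    rw [gamma_zero]
    exact ⟨inferInstance, IsProbabilityMeasure.ne_zero _⟩
  | succ n ih =>
    have := ih.1
    have := S.isProbabilityMeasure_eta_of n ih
    obtain ⟨C, -, -, hC⟩ := S.exists_G_le_of hA1 n (S.theta_mem_closure_of hA1 n)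
    have iG : Integrable (S.G n (S.theta n)) (S.gamma n) :=
      integrable_of_measurable_bdd (S.G_meas n _) hC
    rw [gamma_succ]
    constructor
    · constructor
      rw [push_univ]
      exact iG.lintegral_lt_top
    · rw [Ne, ← Measure.measure_univ_eq_zero, push_univ]
      exact S.lintegral_G_pos n _ _ ih.2

theorem isFiniteMeasure_gamma (S : AdaptiveSMC d E) (hA1 : S.A1) (n : ℕ) :
    IsFiniteMeasure (S.gamma n) := (S.gamma_regular hA1 n).1

theorem isProbabilityMeasure_eta (S : AdaptiveSMC d E) (hA1 : S.A1) (n : ℕ) :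
    IsProbabilityMeasure (S.eta n) := S.isProbabilityMeasure_eta_of n (S.gamma_regular hA1 n)

theorem theta_mem_closure (S : AdaptiveSMC d E) (hA1 : S.A1) (n : ℕ) :
    S.theta n ∈ closure (S.Dom n) :=
  have := S.isProbabilityMeasure_eta hA1 n
  S.theta_mem_closure_of hA1 n

theorem exists_G_le (S : AdaptiveSMC d E) (hA1 : S.A1) (n : ℕ) :
    ∃ C, 1 ≤ C ∧ (∀ x, ∀ ζ ∈ S.Dom n, |S.G n ζ x| ≤ C) ∧ ∀ x, |S.G n (S.theta n) x| ≤ C :=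
  S.exists_G_le_of hA1 n (S.theta_mem_closure hA1 n)

theorem gamma_real_pos (S : AdaptiveSMC d E) (hA1 : S.A1) (n : ℕ) :
    0 < (S.gamma n).real Set.univ := by
  have := S.isFiniteMeasure_gamma hA1 n
  exact ENNReal.toReal_pos (by simpa using (S.gamma_regular hA1 n).2) (measure_ne_top _ _)

theorem integral_gamma (S : AdaptiveSMC d E) (hA1 : S.A1) (n : ℕ)
    {F : Type*} [NormedAddCommGroup F] [NormedSpace ℝ F] (f : E n → F) :
    ∫ x, f x ∂(S.gamma n) = (S.gamma n).real Set.univ • ∫ x, f x ∂(S.eta n) := by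
  rw [eta, normalise, integral_smul_measure, smul_smul, ENNReal.toReal_inv, ← Measure.real,
    mul_inv_cancel₀ (S.gamma_real_pos hA1 n).ne', one_smul]

theorem integral_gamma_succ (S : AdaptiveSMC d E) (hA1 : S.A1) (n : ℕ)
    {φ : E (n + 1) → ℝ} (hφ : IsBddMeasurable φ) :
    ∫ y, φ y ∂(S.gamma (n + 1)) = ∫ x, S.Q n (S.theta n) φ x ∂(S.gamma n) := by
  have := S.isFiniteMeasure_gamma hA1 n
  obtain ⟨C, -, -, hC⟩ := S.exists_G_le hA1 n
  rw [gamma_succ, S.integral_push n _ _ hC hφ]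

theorem isBddMeasurable_Q_theta (S : AdaptiveSMC d E) (hA1 : S.A1) (n : ℕ)
    {φ : E (n + 1) → ℝ} (hφ : IsBddMeasurable φ) : IsBddMeasurable (S.Q n (S.theta n) φ) := by
  obtain ⟨C, hC⟩ := ((hA1 n).2.2.2 φ hφ).1
  exact ⟨S.measurable_Q n _ hφ.1, C,
    IsBddOn.bound_at ((hA1 n).2.2.2 φ hφ).2 (S.theta_mem_closure hA1 n) hC⟩

/-- The `j`-th coordinate of `∂_ξ Q_{n+1} φ`. -/
noncomputable def dQcoord (S : AdaptiveSMC d E) (n : ℕ) (φ : E (n + 1) → ℝ) (j : Fin d)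
    (x : E n) : ℝ :=
  S.dQ n (S.theta n) φ x (EuclideanSpace.basisFun (Fin d) ℝ j)

theorem isBddMeasurable_dQcoord (S : AdaptiveSMC d E) (hA1 : S.A1) (hA2 : S.A2) (n : ℕ)
    {φ : E (n + 1) → ℝ} (hφ : IsBddMeasurable φ) (j : Fin d) :
    IsBddMeasurable (S.dQcoord n φ j) := by
  obtain ⟨C, hC0, -, hC⟩ := S.exists_norm_dQ_le hA2 n (S.theta_mem_closure hA1 n) hφ
  refine ⟨(measurable_dQ_theta S hA2 n (S.theta_mem_closure hA1 n) hφ).apply_continuousLinearMap _,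
    C, fun x => ?_⟩
  have := (S.dQ n (S.theta n) φ x).le_of_opNorm_le (hC x) (EuclideanSpace.basisFun (Fin d) ℝ j)
  rw [OrthonormalBasis.norm_eq_one, mul_one] at this
  exact this

theorem isBddMeasurable_stat_apply (S : AdaptiveSMC d E) (hA1 : S.A1) (n : ℕ) (j : Fin d) :
    IsBddMeasurable (fun x => S.stat n x j) := by
  obtain ⟨C, hC⟩ := (hA1 n).2.2.1
  exact ⟨S.measurable_stat_apply n j, C, fun x => (abs_apply_le_norm _ j).trans (hC x)⟩

theorem theta_apply (S : AdaptiveSMC d E) (hA1 : S.A1) (n : ℕ) (j : Fin d) :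
    S.theta n j = ∫ x, S.stat n x j ∂(S.eta n) := by
  have := S.isProbabilityMeasure_eta hA1 n
  obtain ⟨C, hC⟩ := (hA1 n).2.2.1
  have i : Integrable (S.stat n) (S.eta n) := integrable_of_measurable_bdd (S.stat_meas n) hC
  exact ((EuclideanSpace.proj j : EuclideanSpace ℝ (Fin d) →L[ℝ] ℝ).integral_comp_comm i).symm

/-- In coordinates the operator-valued integral becomes finitely many scalar ones, to which the
scalar law of large numbers applies. -/
theorem L_eq (S : AdaptiveSMC d E) (hA1 : S.A1) (hA2 : S.A2) (n : ℕ)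
    {φ : E (n + 1) → ℝ} (hφ : IsBddMeasurable φ) (x : E n) :
    S.L n φ x = ∑ j, (S.stat n x j - S.theta n j) * ∫ z, S.dQcoord n φ j z ∂(S.eta n)
      + S.Q n (S.theta n) φ x := by
  have := S.isProbabilityMeasure_eta hA1 n
  obtain ⟨C, hC0, -, hC⟩ := S.exists_norm_dQ_le hA2 n (S.theta_mem_closure hA1 n) hφ
  have i : Integrable (S.dQ n (S.theta n) φ) (S.eta n) :=
    Integrable.of_bound (measurable_dQ_theta S hA2 n (S.theta_mem_closure hA1 n)
      hφ).aestronglyMeasurable C (Eventually.of_forall hC)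
  rw [L, clm_apply_eq_sum]
  congr 1
  refine Finset.sum_congr rfl fun j _ => ?_
  rw [ContinuousLinearMap.integral_apply i]
  rfl

theorem isBddMeasurable_L (S : AdaptiveSMC d E) (hA1 : S.A1) (hA2 : S.A2) (n : ℕ)
    {φ : E (n + 1) → ℝ} (hφ : IsBddMeasurable φ) : IsBddMeasurable (S.L n φ) := by
  obtain ⟨hm, K, hK⟩ := S.isBddMeasurable_Q_theta hA1 n hφ
  choose C hC using fun j => (S.isBddMeasurable_stat_apply hA1 n j).2
  rw [show S.L n φ = _ from funext fun x => S.L_eq hA1 hA2 n hφ x]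
  refine ⟨(Finset.measurable_sum _ fun j _ => ((S.measurable_stat_apply n j).sub_const _).mul_const
    _).add hm, ∑ j, (C j + |S.theta n j|) * |∫ z, S.dQcoord n φ j z ∂(S.eta n)| + K, fun x => ?_⟩
  refine (abs_add_le _ _).trans (add_le_add ((Finset.abs_sum_le_sum_abs _ _).trans ?_) (hK x))
  refine Finset.sum_le_sum fun j _ => ?_
  rw [abs_mul]
  gcongr
  exact (abs_sub _ _).trans (add_le_add (hC j x) le_rfl)

/-! ### Measurability in the particles, and the particle system as a Markov chain. -/

theorem integral_empirical_real {X : Type*} [MeasurableSpace X] {N : ℕ} (x : Fin N → X)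
    {f : X → ℝ} (hf : Measurable f) :
    ∫ z, f z ∂(empirical x) = (N : ℝ)⁻¹ * ∑ i, f (x i) :=
  integral_empirical x hf.stronglyMeasurable

theorem measurable_integral_empirical {X : Type*} [MeasurableSpace X] {N : ℕ}
    {f : X → ℝ} (hf : Measurable f) :
    Measurable fun x : Fin N → X => ∫ z, f z ∂(empirical x) := by
  simp_rw [integral_empirical_real _ hf]
  fun_prop

theorem abs_integral_empirical_le {X : Type*} [MeasurableSpace X] {N : ℕ} (hN : 0 < N)
    (x : Fin N → X) {f : X → ℝ} {C : ℝ} (hC : ∀ x, |f x| ≤ C) :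
    |∫ z, f z ∂(empirical x)| ≤ C := by
  have := isProbabilityMeasure_empirical hN x
  have := norm_integral_le_of_norm_le_const (μ := empirical x) (f := f) (C := C)
    (Eventually.of_forall hC)
  simpa using this

theorem thetaN_eq (S : AdaptiveSMC d E) {N : ℕ} (n : ℕ) (x : Fin N → E n) :
    S.thetaN n x = (N : ℝ)⁻¹ • ∑ i, S.stat n (x i) :=
  integral_empirical x (S.stat_meas n).stronglyMeasurable

theorem thetaN_mem (S : AdaptiveSMC d E) {N : ℕ} (hN : 0 < N) (n : ℕ) (x : Fin N → E n) :
    S.thetaN n x ∈ S.Dom n := by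
  rw [thetaN_eq, Finset.smul_sum]
  refine (S.Dom_convex n).sum_mem (fun _ _ => by positivity) ?_ (fun i _ => S.stat_mem n (x i))
  have : (N : ℝ) ≠ 0 := by exact_mod_cast hN.ne'
  simp [this]

theorem measurable_thetaN (S : AdaptiveSMC d E) {N : ℕ} (n : ℕ) :
    Measurable (S.thetaN n : (Fin N → E n) → _) := by
  rw [show (S.thetaN n : (Fin N → E n) → _) = _ from funext (S.thetaN_eq n)]
  exact (Finset.measurable_sum _ fun i _ =>
    (S.stat_meas n).comp (measurable_pi_apply i)).const_smul (N : ℝ)⁻¹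

theorem thetaN_apply (S : AdaptiveSMC d E) {N : ℕ} (n : ℕ) (x : Fin N → E n) (j : Fin d) :
    S.thetaN n x j = ∫ z, S.stat n z j ∂(empirical x) := by
  rw [thetaN_eq, integral_empirical_real x (S.measurable_stat_apply n j)]
  simp

/-- Carathéodory's criterion: Q is continuous in the parameter on `Dom`, by (A2), and measurable in
x; for N > 0 the adapted parameter stays in `Dom`. -/
theorem measurable_Q_thetaN (S : AdaptiveSMC d E) (hA2 : S.A2) {N : ℕ} (hN : 0 < N) (n : ℕ)
    {φ : E (n + 1) → ℝ} (hφ : IsBddMeasurable φ) (i : Fin N) :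
    Measurable fun x : Fin N → E n => S.Q n (S.thetaN n x) φ (x i) := by
  have h : Measurable (Function.uncurry fun (ζ : S.Dom n) (x : E n) => S.Q n ζ φ x) :=
    measurable_uncurry_of_continuous_of_measurable
      (fun x => continuous_iff_continuousAt.2 fun ζ =>
        (((hA2 n φ hφ).1 x ζ ζ.2).continuousAt.comp
          (f := fun ζ : S.Dom n => (ζ : EuclideanSpace ℝ (Fin d))) continuous_subtype_val.continuousAt))
      (fun ζ => S.measurable_Q n ζ hφ.1)
  exact h.comp (((S.measurable_thetaN n).subtype_mk (h := S.thetaN_mem hN n)).prodMk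
    (measurable_pi_apply i))

theorem measurable_integral_Q_thetaN (S : AdaptiveSMC d E) (hA2 : S.A2) {N : ℕ} (hN : 0 < N)
    (n : ℕ) {φ : E (n + 1) → ℝ} (hφ : IsBddMeasurable φ) :
    Measurable fun x : Fin N → E n => ∫ z, S.Q n (S.thetaN n x) φ z ∂(empirical x) := by
  simp_rw [integral_empirical_real _ (S.measurable_Q n _ hφ.1)]
  exact (Finset.measurable_sum _ fun i _ => S.measurable_Q_thetaN hA2 hN n hφ i).const_mul _

theorem measurable_integral_G_thetaN (S : AdaptiveSMC d E) (hA2 : S.A2) {N : ℕ} (hN : 0 < N)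
    (n : ℕ) :
    Measurable fun x : Fin N → E n => ∫ z, S.G n (S.thetaN n x) z ∂(empirical x) := by
  simp_rw [← Q_one]
  exact S.measurable_integral_Q_thetaN hA2 hN n (isBddMeasurable_const 1)

theorem integral_G_thetaN_pos (S : AdaptiveSMC d E) (hA1 : S.A1) {N : ℕ} (hN : 0 < N)
    (n : ℕ) (x : Fin N → E n) : 0 < ∫ z, S.G n (S.thetaN n x) z ∂(empirical x) := by
  have := isProbabilityMeasure_empirical hN x
  obtain ⟨C, -, hC, -⟩ := S.exists_G_le hA1 n
  exact S.integral_G_pos n _ _ (IsProbabilityMeasure.ne_zero _)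
    (fun y => hC y _ (S.thetaN_mem hN n x))

/-- The law of a new particle given the previous generation. -/
noncomputable def PhiN (S : AdaptiveSMC d E) {N : ℕ} (n : ℕ) (x : Fin N → E n) :
    Measure (E (n + 1)) :=
  S.Phi n (S.thetaN n x) (empirical x)

theorem isProbabilityMeasure_PhiN (S : AdaptiveSMC d E) (hA1 : S.A1) {N : ℕ} (hN : 0 < N)
    (n : ℕ) (x : Fin N → E n) : IsProbabilityMeasure (S.PhiN n x) := by
  have := isProbabilityMeasure_empirical hN x
  obtain ⟨C, -, hC, -⟩ := S.exists_G_le hA1 n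
  exact S.isProbabilityMeasure_Phi n _ _ (IsProbabilityMeasure.ne_zero _)
    (fun y => hC y _ (S.thetaN_mem hN n x))

theorem integral_PhiN (S : AdaptiveSMC d E) (hA1 : S.A1) {N : ℕ} (hN : 0 < N)
    (n : ℕ) (x : Fin N → E n) {φ : E (n + 1) → ℝ} (hφ : IsBddMeasurable φ) :
    ∫ y, φ y ∂(S.PhiN n x) = (∫ z, S.G n (S.thetaN n x) z ∂(empirical x))⁻¹ *
      ∫ z, S.Q n (S.thetaN n x) φ z ∂(empirical x) := by
  have := isProbabilityMeasure_empirical hN x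
  obtain ⟨C, -, hC, -⟩ := S.exists_G_le hA1 n
  exact S.integral_Phi n _ _ (fun y => hC y _ (S.thetaN_mem hN n x)) hφ

theorem isBddMeasurable_indicator {X : Type*} [MeasurableSpace X] {A : Set X}
    (hA : MeasurableSet A) : IsBddMeasurable (A.indicator fun _ => (1 : ℝ)) := by
  refine ⟨measurable_const.indicator hA, 1, fun x => ?_⟩
  by_cases h : x ∈ A <;> simp [h]

/-- The mass of a set A is a quotient of empirical integrals, with the indicator of A as test
function. -/
theorem measurable_PhiN (S : AdaptiveSMC d E) (hA1 : S.A1) (hA2 : S.A2) {N : ℕ} (hN : 0 < N)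
    (n : ℕ) : Measurable (S.PhiN n : (Fin N → E n) → _) := by
  refine Measure.measurable_of_measurable_coe _ fun A hA => ?_
  have h : ∀ x : Fin N → E n, S.PhiN n x A = ENNReal.ofReal
      ((∫ z, S.G n (S.thetaN n x) z ∂(empirical x))⁻¹ *
      ∫ z, S.Q n (S.thetaN n x) (A.indicator fun _ => (1 : ℝ)) z ∂(empirical x)) := fun x => by
    have := S.isProbabilityMeasure_PhiN hA1 hN n x
    rw [← S.integral_PhiN hA1 hN n x (isBddMeasurable_indicator hA), integral_indicator_const _ hA]
    simp
  simp_rw [h]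
  exact ((S.measurable_integral_G_thetaN hA2 hN n).inv.mul
    (S.measurable_integral_Q_thetaN hA2 hN n (isBddMeasurable_indicator hA))).ennreal_ofReal

theorem measurable_measure_pi {α X : Type*} [MeasurableSpace α] [MeasurableSpace X] {N : ℕ}
    {ν : α → Measure X} (hν : Measurable ν) (hp : ∀ a, IsProbabilityMeasure (ν a)) :
    Measurable fun a => Measure.pi fun _ : Fin N => ν a := by
  refine Measurable.measure_of_isPiSystem_of_isProbabilityMeasure generateFrom_pi.symm
    isPiSystem_pi ?_
  rintro s ⟨t, ht, rfl⟩
  simp_rw [Measure.pi_pi]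
  exact Finset.measurable_prod _ fun i _ =>
    (Measure.measurable_coe (ht i (Set.mem_univ i))).comp hν

theorem measurable_pi_PhiN (S : AdaptiveSMC d E) (hA1 : S.A1) (hA2 : S.A2) (N n : ℕ) :
    Measurable fun x : Fin N → E n => Measure.pi fun _ : Fin N => S.PhiN n x := by
  rcases N.eq_zero_or_pos with rfl | hN
  · exact Subsingleton.measurable
  · exact measurable_measure_pi (S.measurable_PhiN hA1 hA2 hN n)
      (S.isProbabilityMeasure_PhiN hA1 hN n)

/-- The transition kernel of the particle system. -/
noncomputable def transition (S : AdaptiveSMC d E) (hA1 : S.A1) (hA2 : S.A2) (N n : ℕ) :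
    Kernel (Fin N → E n) (Fin N → E (n + 1)) :=
  ⟨fun x => Measure.pi fun _ : Fin N => S.PhiN n x, S.measurable_pi_PhiN hA1 hA2 N n⟩

instance (S : AdaptiveSMC d E) (hA1 : S.A1) (hA2 : S.A2) (N n : ℕ) :
    IsMarkovKernel (S.transition hA1 hA2 N n) := by
  constructor
  intro x
  change IsProbabilityMeasure (Measure.pi fun _ : Fin N => S.PhiN n x)
  -- For N = 0 the empirical measure vanishes and `PhiN` is no probability, but a product over an
  -- empty index set is a Dirac mass.
  rcases N.eq_zero_or_pos with rfl | hN
  · rw [Measure.pi_of_empty]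
    infer_instance
  · have := S.isProbabilityMeasure_PhiN hA1 hN n x
    infer_instance

/-- The law of the next generation of particles given the history. -/
noncomputable def historyTransition (S : AdaptiveSMC d E) (hA1 : S.A1) (hA2 : S.A2) (N n : ℕ) :
    Kernel (Hist (fun p => Fin N → E p) n) (Fin N → E (n + 1)) :=
  (S.transition hA1 hA2 N n).comap (fun h => h.last)
    (Hist.measurable_last (E := fun p => Fin N → E p))

instance (S : AdaptiveSMC d E) (hA1 : S.A1) (hA2 : S.A2) (N n : ℕ) :
    IsMarkovKernel (S.historyTransition hA1 hA2 N n) :=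
  inferInstanceAs (IsMarkovKernel ((S.transition hA1 hA2 N n).comap _ _))

/-- Rewrites the law as a composition product, which gives the Fubini formula for conditioning on
the history. -/
theorem smcLaw_succ_of (S : AdaptiveSMC d E) (hA1 : S.A1) (hA2 : S.A2) (N n : ℕ)
    [SFinite (S.smcLaw N n)] :
    S.smcLaw N (n + 1) = S.smcLaw N n ⊗ₘ
      S.historyTransition hA1 hA2 N n := by
  set κ := S.historyTransition hA1 hA2 N n with hκ
  have hm : ∀ A : Set (Hist (fun p => Fin N → E p) n × (Fin N → E (n + 1))), MeasurableSet A →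
      ∀ h, ((κ h).map (Prod.mk h)) A = κ h (Prod.mk h ⁻¹' A) := fun A hA h =>
    Measure.map_apply measurable_prodMk_left hA
  have hmeas : Measurable fun h => (κ h).map (Prod.mk h) := by
    refine Measure.measurable_of_measurable_coe _ fun A hA => ?_
    simp_rw [hm A hA]
    exact Kernel.measurable_kernel_prodMk_left hA
  change (S.smcLaw N n).bind (fun h => (κ h).map (Prod.mk h)) = _
  refine Measure.ext fun A hA => ?_
  refine (Measure.bind_apply hA hmeas.aemeasurable).trans ?_
  refine Eq.trans ?_ (Measure.compProd_apply hA).symm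
  exact lintegral_congr fun h => hm A hA h

theorem isProbabilityMeasure_smcLaw (S : AdaptiveSMC d E) (hA1 : S.A1) (hA2 : S.A2) (N n : ℕ) :
    IsProbabilityMeasure (S.smcLaw N n) := by
  induction n with
  | zero => exact inferInstanceAs (IsProbabilityMeasure (Measure.pi fun _ : Fin N => S.init))
  | succ n ih =>
    rw [smcLaw_succ_of S hA1 hA2]
    exact inferInstanceAs (IsProbabilityMeasure (S.smcLaw N n ⊗ₘ
      S.historyTransition hA1 hA2 N n))

theorem integral_smcLaw_succ (S : AdaptiveSMC d E) (hA1 : S.A1) (hA2 : S.A2) (N n : ℕ)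
    {F : Type*} [NormedAddCommGroup F] [NormedSpace ℝ F] [MeasurableSpace F] [BorelSpace F]
    [SecondCountableTopology F]
    {f : Hist (fun p => Fin N → E p) (n + 1) → F} (hf : Measurable f) {C : ℝ}
    (hC : ∀ h, ‖f h‖ ≤ C) :
    ∫ h, f h ∂(S.smcLaw N (n + 1)) =
      ∫ h, ∫ x, f (h, x) ∂(Measure.pi fun _ : Fin N => S.PhiN n h.last) ∂(S.smcLaw N n) := by
  have := S.isProbabilityMeasure_smcLaw hA1 hA2 N n
  rw [smcLaw_succ_of S hA1 hA2]
  exact Measure.integral_compProd (integrable_of_measurable_bdd (μ := S.smcLaw N n ⊗ₘ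
    S.historyTransition hA1 hA2 N n) hf hC)

/-! ### The normalising constants of the particle system -/

theorem prodGN_pos (S : AdaptiveSMC d E) (hA1 : S.A1) {N : ℕ} (hN : 0 < N) (n : ℕ)
    (h : Hist (fun p => Fin N → E p) n) : 0 < S.prodGN N n h := by
  induction n with
  | zero => exact one_pos
  | succ n ih => exact mul_pos (ih h.1) (S.integral_G_thetaN_pos hA1 hN n _)

theorem measurable_prodGN (S : AdaptiveSMC d E) (hA2 : S.A2) {N : ℕ} (hN : 0 < N) (n : ℕ) :
    Measurable (S.prodGN N n) := by
  induction n with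
  | zero => exact measurable_const
  | succ n ih =>
    have hfst : Measurable (Prod.fst : Hist (fun p => Fin N → E p) n × (Fin N → E (n + 1)) → _) :=
      measurable_fst
    exact (ih.comp hfst).mul ((S.measurable_integral_G_thetaN hA2 hN n).comp
      (Hist.measurable_last.comp hfst))

/-- What matters is that the bound does not depend on N. -/
theorem exists_prodGN_le (S : AdaptiveSMC d E) (hA1 : S.A1) (n : ℕ) :
    ∃ C, 0 ≤ C ∧ ∀ N, 0 < N → ∀ h : Hist (fun p => Fin N → E p) n, S.prodGN N n h ≤ C := by
  induction n with
  | zero => exact ⟨1, zero_le_one, fun _ _ _ => le_rfl⟩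
  | succ n ih =>
    obtain ⟨C, hC0, hC⟩ := ih
    obtain ⟨D, hD1, hD, -⟩ := S.exists_G_le hA1 n
    refine ⟨C * D, by positivity, fun N hN h => ?_⟩
    refine mul_le_mul (hC N hN h.1) ?_ (S.integral_G_thetaN_pos hA1 hN n _).le hC0
    exact (le_abs_self _).trans (abs_integral_empirical_le hN _
      fun y => hD y _ (S.thetaN_mem hN n _))

theorem prodGN_succ (S : AdaptiveSMC d E) {N : ℕ} (n : ℕ)
    (h : Hist (fun p => Fin N → E p) n) (x : Fin N → E (n + 1)) :
    S.prodGN N (n + 1) (h, x) =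
      S.prodGN N n h * ∫ z, S.G n (S.thetaN n h.last) z ∂(empirical h.last) := rfl

/-- The normaliser of Φ is the last factor of the product, so the conditional mean of γ_{n+1}^N(φ)
contains no random denominator. -/
theorem prodGN_mul_integral_PhiN (S : AdaptiveSMC d E) (hA1 : S.A1) {N : ℕ} (hN : 0 < N)
    (n : ℕ) (h : Hist (fun p => Fin N → E p) n) (x : Fin N → E (n + 1)) {φ : E (n + 1) → ℝ}
    (hφ : IsBddMeasurable φ) :
    S.prodGN N (n + 1) (h, x) * ∫ y, φ y ∂(S.PhiN n h.last) =
      S.gammaN N n (S.Q n (S.thetaN n h.last) φ) h := by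
  have hpos := S.integral_G_thetaN_pos hA1 hN n h.last
  rw [prodGN_succ, S.integral_PhiN hA1 hN n _ hφ, gammaN]
  field_simp

theorem measurable_gammaN (S : AdaptiveSMC d E) (hA2 : S.A2) {N : ℕ} (hN : 0 < N) (n : ℕ)
    {φ : E n → ℝ} (hφ : Measurable φ) : Measurable (S.gammaN N n φ) :=
  (S.measurable_prodGN hA2 hN n).mul
    ((measurable_integral_empirical hφ).comp Hist.measurable_last)

end AdaptiveSMC

/-! ### Calculus of random sequences of size N^{-1/2} in mean square. -/

section RootSmall

variable {Ω : ℕ → Type*} [∀ N, MeasurableSpace (Ω N)]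

/-- A sequence of random variables, each measurable, and bounded uniformly in `N ≥ 1`. -/
def BddSeq (Z : ∀ N, Ω N → ℝ) : Prop :=
  ∃ C : ℝ, ∀ N, 0 < N → Measurable (Z N) ∧ ∀ ω, |Z N ω| ≤ C

/-- A bounded sequence of random variables with second moments of order `1 / N`. -/
def RootSmall (P : ∀ N, Measure (Ω N)) (Z : ∀ N, Ω N → ℝ) : Prop :=
  BddSeq Z ∧ ∃ C : ℝ, ∀ N : ℕ, 0 < N → ∫ ω, Z N ω ^ 2 ∂(P N) ≤ C / N

namespace BddSeq

variable {Y Z : ∀ N, Ω N → ℝ}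

theorem add (hY : BddSeq Y) (hZ : BddSeq Z) : BddSeq fun N ω => Y N ω + Z N ω := by
  obtain ⟨C, hC⟩ := hY
  obtain ⟨D, hD⟩ := hZ
  exact ⟨C + D, fun N hN => ⟨(hC N hN).1.add (hD N hN).1, fun ω =>
    (abs_add_le _ _).trans (add_le_add ((hC N hN).2 ω) ((hD N hN).2 ω))⟩⟩

theorem mul (hY : BddSeq Y) (hZ : BddSeq Z) : BddSeq fun N ω => Y N ω * Z N ω := by
  obtain ⟨C, hC⟩ := hY
  obtain ⟨D, hD⟩ := hZ
  refine ⟨C * D, fun N hN => ⟨(hC N hN).1.mul (hD N hN).1, fun ω => ?_⟩⟩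
  rw [abs_mul]
  exact mul_le_mul ((hC N hN).2 ω) ((hD N hN).2 ω) (abs_nonneg _)
    ((abs_nonneg _).trans ((hC N hN).2 ω))

theorem abs (hY : BddSeq Y) : BddSeq fun N ω => |Y N ω| := by
  obtain ⟨C, hC⟩ := hY
  exact ⟨C, fun N hN => ⟨(hC N hN).1.abs, fun ω => by rw [abs_abs]; exact (hC N hN).2 ω⟩⟩

theorem const (c : ℝ) : BddSeq fun (N : ℕ) (_ : Ω N) => c :=
  ⟨|c|, fun _ _ => ⟨measurable_const, fun _ => le_rfl⟩⟩

theorem sub (hY : BddSeq Y) (hZ : BddSeq Z) : BddSeq fun N ω => Y N ω - Z N ω := by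
  have := hY.add ((const (-1)).mul hZ)
  simpa [sub_eq_add_neg] using this

theorem integrable (hY : BddSeq Y) {P : ∀ N, Measure (Ω N)} [∀ N, IsProbabilityMeasure (P N)]
    {N : ℕ} (hN : 0 < N) : Integrable (Y N) (P N) := by
  obtain ⟨C, hC⟩ := hY
  exact integrable_of_measurable_bdd (hC N hN).1 (hC N hN).2

theorem integrable_sq (hY : BddSeq Y) {P : ∀ N, Measure (Ω N)} [∀ N, IsProbabilityMeasure (P N)]
    {N : ℕ} (hN : 0 < N) : Integrable (fun ω => Y N ω ^ 2) (P N) := by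
  simpa [sq] using (hY.mul hY).integrable (P := P) hN

end BddSeq

namespace RootSmall

theorem zero (P : ∀ N, Measure (Ω N)) : RootSmall P fun _ _ => 0 :=
  ⟨BddSeq.const 0, 0, fun N _ => by simp⟩

variable {P : ∀ N, Measure (Ω N)} [∀ N, IsProbabilityMeasure (P N)] {Y Z : ∀ N, Ω N → ℝ}

theorem of_abs_le (hY : RootSmall P Y) (hZ : BddSeq Z) {K : ℝ}
    (h : ∀ N, 0 < N → ∀ ω, |Z N ω| ≤ K * |Y N ω|) : RootSmall P Z := by
  obtain ⟨hYb, C, hC⟩ := hY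
  refine ⟨hZ, K ^ 2 * C, fun N hN => ?_⟩
  calc ∫ ω, Z N ω ^ 2 ∂(P N) ≤ ∫ ω, K ^ 2 * Y N ω ^ 2 ∂(P N) := by
        refine integral_mono (hZ.integrable_sq hN) ((hYb.integrable_sq hN).const_mul _) fun ω => ?_
        show Z N ω ^ 2 ≤ K ^ 2 * Y N ω ^ 2
        rw [← sq_abs (Z N ω), ← sq_abs (Y N ω), ← mul_pow]
        gcongr
        exact h N hN ω
    _ ≤ K ^ 2 * (C / N) := by
        rw [integral_const_mul]
        gcongr
        exact hC N hN
    _ = _ := by ring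

theorem add (hY : RootSmall P Y) (hZ : RootSmall P Z) :
    RootSmall P fun N ω => Y N ω + Z N ω := by
  obtain ⟨hYb, C, hC⟩ := hY
  obtain ⟨hZb, D, hD⟩ := hZ
  refine ⟨hYb.add hZb, 2 * C + 2 * D, fun N hN => ?_⟩
  calc ∫ ω, (Y N ω + Z N ω) ^ 2 ∂(P N) ≤ ∫ ω, (2 * Y N ω ^ 2 + 2 * Z N ω ^ 2) ∂(P N) := by
        refine integral_mono ((hYb.add hZb).integrable_sq hN)
          (((hYb.integrable_sq hN).const_mul _).add ((hZb.integrable_sq hN).const_mul _))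
          fun ω => ?_
        show (Y N ω + Z N ω) ^ 2 ≤ 2 * Y N ω ^ 2 + 2 * Z N ω ^ 2
        nlinarith [sq_nonneg (Y N ω - Z N ω)]
    _ ≤ 2 * (C / N) + 2 * (D / N) := by
        rw [integral_add ((hYb.integrable_sq hN).const_mul _)
          ((hZb.integrable_sq hN).const_mul _), integral_const_mul, integral_const_mul]
        gcongr
        · exact hC N hN
        · exact hD N hN
    _ = _ := by ring

theorem abs (hY : RootSmall P Y) : RootSmall P fun N ω => |Y N ω| :=
  hY.of_abs_le hY.1.abs (K := 1) fun N _ ω => by simp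

theorem bdd_mul (hZ : BddSeq Z) (hY : RootSmall P Y) :
    RootSmall P fun N ω => Z N ω * Y N ω := by
  have hb := hZ
  obtain ⟨C, hC⟩ := hZ
  refine hY.of_abs_le (hb.mul hY.1) (K := C) fun N hN ω => ?_
  rw [abs_mul]
  exact mul_le_mul_of_nonneg_right ((hC N hN).2 ω) (abs_nonneg _)

theorem sum {ι : Type*} (s : Finset ι) {Z : ι → ∀ N, Ω N → ℝ} (h : ∀ i, RootSmall P (Z i)) :
    RootSmall P fun N ω => ∑ i ∈ s, Z i N ω := by
  classical
  induction s using Finset.induction_on with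
  | empty => simpa using zero P
  | insert i s hi ih =>
    simp only [Finset.sum_insert hi]
    exact (h i).add ih

theorem integral_abs_mul_le (hY : RootSmall P Y) (hZ : RootSmall P Z) :
    ∃ C : ℝ, ∀ N : ℕ, 0 < N → ∫ ω, |Y N ω * Z N ω| ∂(P N) ≤ C / N := by
  obtain ⟨hYb, C, hC⟩ := hY
  obtain ⟨hZb, D, hD⟩ := hZ
  refine ⟨C + D, fun N hN => ?_⟩
  calc ∫ ω, |Y N ω * Z N ω| ∂(P N) ≤ ∫ ω, (Y N ω ^ 2 + Z N ω ^ 2) ∂(P N) := by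
        refine integral_mono ((hYb.mul hZb).abs.integrable hN)
          ((hYb.integrable_sq hN).add (hZb.integrable_sq hN)) fun ω => ?_
        show |Y N ω * Z N ω| ≤ Y N ω ^ 2 + Z N ω ^ 2
        rw [abs_mul, ← sq_abs (Y N ω), ← sq_abs (Z N ω)]
        nlinarith [sq_nonneg (|Y N ω| - |Z N ω|), abs_nonneg (Y N ω), abs_nonneg (Z N ω)]
    _ ≤ C / N + D / N := by
        rw [integral_add (hYb.integrable_sq hN) (hZb.integrable_sq hN)]
        exact add_le_add (hC N hN) (hD N hN)
    _ = _ := by ring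

/-- The pointwise inequality u ≤ 1 + u² at u = √N |Y| replaces Cauchy–Schwarz. -/
theorem integral_abs_le (hY : RootSmall P Y) :
    ∃ C : ℝ, ∀ N : ℕ, 0 < N → √(N : ℝ) * ∫ ω, |Y N ω| ∂(P N) ≤ C := by
  obtain ⟨hYb, C, hC⟩ := hY
  refine ⟨1 + C, fun N hN => ?_⟩
  have hN' : (0 : ℝ) < N := by exact_mod_cast hN
  have hs : √(N : ℝ) ^ 2 = N := Real.sq_sqrt hN'.le
  rw [← integral_const_mul]
  calc ∫ ω, √(N : ℝ) * |Y N ω| ∂(P N) ≤ ∫ ω, (1 + N * Y N ω ^ 2) ∂(P N) := by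
        refine integral_mono ((hYb.abs.integrable hN).const_mul _)
          ((integrable_const _).add ((hYb.integrable_sq hN).const_mul _)) fun ω => ?_
        show √(N : ℝ) * |Y N ω| ≤ 1 + N * Y N ω ^ 2
        have h2 : N * Y N ω ^ 2 = (√(N : ℝ) * |Y N ω|) ^ 2 := by rw [mul_pow, hs, sq_abs]
        rw [h2]
        nlinarith [sq_nonneg (√(N : ℝ) * |Y N ω| - 1), sq_nonneg (√(N : ℝ) * |Y N ω|)]
    _ ≤ 1 + N * (C / N) := by
        rw [integral_add (integrable_const _) ((hYb.integrable_sq hN).const_mul _),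
          integral_const_mul]
        simp only [integral_const, probReal_univ, smul_eq_mul, mul_one]
        gcongr
        exact hC N hN
    _ = _ := by field_simp

theorem tendsto_integral_abs (hY : RootSmall P Y) :
    Tendsto (fun N => ∫ ω, |Y N ω| ∂(P N)) atTop (𝓝 0) := by
  obtain ⟨C, hC⟩ := hY.integral_abs_le
  have hlim : Tendsto (fun N : ℕ => C / √(N : ℝ)) atTop (𝓝 0) :=
    tendsto_const_nhds.div_atTop (Real.tendsto_sqrt_atTop.comp tendsto_natCast_atTop_atTop)
  refine squeeze_zero' (Eventually.of_forall fun N => integral_nonneg fun ω => abs_nonneg _) ?_ hlim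
  filter_upwards [eventually_gt_atTop 0] with N hN
  have hN' : (0 : ℝ) < N := by exact_mod_cast hN
  rw [le_div_iff₀ (Real.sqrt_pos.2 hN'), mul_comm]
  exact hC N hN

end RootSmall

end RootSmall

/-! ### The mean-square law of large numbers. -/

namespace AdaptiveSMC

variable {d : ℕ} {E : ℕ → Type*} [∀ n, MeasurableSpace (E n)]

theorem integral_empirical_sub_const {X : Type*} [MeasurableSpace X] {N : ℕ} (hN : 0 < N)
    (x : Fin N → X) {φ : X → ℝ} (hφ : Measurable φ) (c : ℝ) :
    ∫ z, φ z ∂(empirical x) - c = (N : ℝ)⁻¹ * ∑ i, (φ (x i) - c) := by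
  have hN' : (N : ℝ) ≠ 0 := by exact_mod_cast hN.ne'
  rw [integral_empirical_real x hφ, Finset.sum_sub_distrib, mul_sub]
  simp [hN']

theorem abs_integral_le {X : Type*} [MeasurableSpace X] (ν : Measure X) [IsProbabilityMeasure ν]
    {φ : X → ℝ} {K : ℝ} (hK : ∀ x, |φ x| ≤ K) : |∫ x, φ x ∂ν| ≤ K := by
  have := norm_integral_le_of_norm_le_const (μ := ν) (f := φ) (C := K) (Eventually.of_forall hK)
  simpa using this

theorem abs_sub_integral_le {X : Type*} [MeasurableSpace X] (ν : Measure X)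
    [IsProbabilityMeasure ν] {φ : X → ℝ} {K : ℝ} (hK : ∀ x, |φ x| ≤ K) (x : X) :
    |φ x - ∫ x, φ x ∂ν| ≤ 2 * K := by
  have h1 := abs_sub (φ x) (∫ x, φ x ∂ν)
  have h2 := abs_integral_le ν hK
  linarith [hK x]

theorem integral_sub_integral_eq_zero {X : Type*} [MeasurableSpace X] (ν : Measure X)
    [IsProbabilityMeasure ν] {φ : X → ℝ} (hφ : IsBddMeasurable φ) :
    ∫ x, (φ x - ∫ x, φ x ∂ν) ∂ν = 0 := by
  obtain ⟨hm, K, hK⟩ := hφ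
  rw [integral_sub (integrable_of_measurable_bdd hm hK) (integrable_const _)]
  simp

theorem integral_pi_sq_empirical_sub_le {X : Type*} [MeasurableSpace X] (ν : Measure X)
    [IsProbabilityMeasure ν] {φ : X → ℝ} (hm : Measurable φ) {K : ℝ} (hK : ∀ x, |φ x| ≤ K)
    {N : ℕ} (hN : 0 < N) :
    ∫ x : Fin N → X, (∫ z, φ z ∂(empirical x) - ∫ z, φ z ∂ν) ^ 2 ∂(Measure.pi fun _ => ν)
      ≤ (2 * K) ^ 2 / N := by
  simp_rw [integral_empirical_sub_const hN _ hm]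
  exact integral_pi_sq_average_le (hm.sub_const _) (abs_sub_integral_le ν hK)
    (integral_sub_integral_eq_zero ν ⟨hm, K, hK⟩) hN

theorem bddSeq_prodGN (S : AdaptiveSMC d E) (hA1 : S.A1) (hA2 : S.A2) (n : ℕ) :
    BddSeq fun N => S.prodGN N n := by
  obtain ⟨C, -, hC⟩ := S.exists_prodGN_le hA1 n
  exact ⟨C, fun N hN => ⟨S.measurable_prodGN hA2 hN n, fun h => by
    rw [abs_of_pos (S.prodGN_pos hA1 hN n h)]; exact hC N hN h⟩⟩

theorem bddSeq_integral_empirical (n : ℕ) {φ : E n → ℝ} (hφ : IsBddMeasurable φ) :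
    BddSeq fun N (h : Hist (fun p => Fin N → E p) n) => ∫ z, φ z ∂(empirical h.last) := by
  obtain ⟨hm, K, hK⟩ := hφ
  exact ⟨K, fun N hN => ⟨(measurable_integral_empirical hm).comp Hist.measurable_last,
    fun h => abs_integral_empirical_le hN _ hK⟩⟩

theorem bddSeq_gammaN (S : AdaptiveSMC d E) (hA1 : S.A1) (hA2 : S.A2) (n : ℕ)
    {φ : E n → ℝ} (hφ : IsBddMeasurable φ) : BddSeq fun N => S.gammaN N n φ :=
  (S.bddSeq_prodGN hA1 hA2 n).mul (bddSeq_integral_empirical n hφ)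

theorem bddSeq_integral_Q_thetaN (S : AdaptiveSMC d E) (hA1 : S.A1) (hA2 : S.A2) (n : ℕ)
    {φ : E (n + 1) → ℝ} (hφ : IsBddMeasurable φ) :
    BddSeq fun N (h : Hist (fun p => Fin N → E p) n) =>
      ∫ z, S.Q n (S.thetaN n h.last) φ z ∂(empirical h.last) := by
  obtain ⟨C, hC⟩ := ((hA1 n).2.2.2 φ hφ).1
  exact ⟨C, fun N hN => ⟨(S.measurable_integral_Q_thetaN hA2 hN n hφ).comp Hist.measurable_last,
    fun h => abs_integral_empirical_le hN _ fun x => hC x _ (S.thetaN_mem hN n _)⟩⟩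

theorem bddSeq_gammaN_Q_thetaN (S : AdaptiveSMC d E) (hA1 : S.A1) (hA2 : S.A2) (n : ℕ)
    {φ : E (n + 1) → ℝ} (hφ : IsBddMeasurable φ) :
    BddSeq fun N (h : Hist (fun p => Fin N → E p) n) =>
      S.gammaN N n (S.Q n (S.thetaN n h.last) φ) h :=
  (S.bddSeq_prodGN hA1 hA2 n).mul (S.bddSeq_integral_Q_thetaN hA1 hA2 n hφ)

theorem gammaN_one (S : AdaptiveSMC d E) {N : ℕ} (hN : 0 < N) (n : ℕ)
    (h : Hist (fun p => Fin N → E p) n) : S.gammaN N n (fun _ => 1) h = S.prodGN N n h := by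
  have := isProbabilityMeasure_empirical hN h.last
  simp [gammaN]

/-- The law of large numbers, in mean square, for the unnormalised particle measures. -/
def MeanSquareLLN (S : AdaptiveSMC d E) (n : ℕ) : Prop :=
  ∀ φ : E n → ℝ, IsBddMeasurable φ → RootSmall (fun N => S.smcLaw N n)
    (fun N h => S.gammaN N n φ h - ∫ x, φ x ∂(S.gamma n))

/-- The identity γ_n(1)(η_n^N φ - η_n φ) = (γ_n^N φ - γ_n φ) - η_n^N(φ)(γ_n^N(1) - γ_n(1)) divides
only by the deterministic γ_n(1); the random γ_n^N(1) has no uniform positive lower bound. -/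
theorem rootSmall_integral_empirical (S : AdaptiveSMC d E) (hA1 : S.A1) (hA2 : S.A2) {n : ℕ}
    (hn : S.MeanSquareLLN n) {φ : E n → ℝ} (hφ : IsBddMeasurable φ) :
    RootSmall (fun N => S.smcLaw N n)
      (fun _ h => ∫ z, φ z ∂(empirical h.last) - ∫ x, φ x ∂(S.eta n)) := by
  have := fun N => S.isProbabilityMeasure_smcLaw hA1 hA2 N n
  have hg := S.gamma_real_pos hA1 n
  have h1 := RootSmall.bdd_mul (bddSeq_integral_empirical n hφ)
    (hn _ (isBddMeasurable_const 1))
  have h2 := RootSmall.bdd_mul (BddSeq.const (-1)) h1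
  refine ((hn φ hφ).add h2).of_abs_le
    ((bddSeq_integral_empirical n hφ).sub (BddSeq.const _))
    (K := ((S.gamma n).real Set.univ)⁻¹) fun N hN h => ?_
  have e : S.gammaN N n φ h - ∫ x, φ x ∂(S.gamma n) + -1 * ((∫ z, φ z ∂(empirical h.last)) *
      (S.gammaN N n (fun _ => 1) h - ∫ _, (1 : ℝ) ∂(S.gamma n)))
      = (S.gamma n).real Set.univ *
        (∫ z, φ z ∂(empirical h.last) - ∫ x, φ x ∂(S.eta n)) := by
    rw [S.gammaN_one hN, gammaN, S.integral_gamma hA1 n φ]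
    simp only [integral_const, smul_eq_mul]
    ring
  rw [e, abs_mul, abs_of_pos hg, ← mul_assoc, inv_mul_cancel₀ hg.ne', one_mul]

theorem rootSmall_thetaN (S : AdaptiveSMC d E) (hA1 : S.A1) (hA2 : S.A2) {n : ℕ}
    (hn : S.MeanSquareLLN n) :
    RootSmall (fun N => S.smcLaw N n) (fun _ h => ‖S.thetaN n h.last - S.theta n‖) := by
  have := fun N => S.isProbabilityMeasure_smcLaw hA1 hA2 N n
  have hs : RootSmall (fun N => S.smcLaw N n)
      (fun N h => ∑ j, |S.thetaN n h.last j - S.theta n j|) := by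
    simp_rw [thetaN_apply, S.theta_apply hA1]
    exact RootSmall.sum _ fun j =>
      (S.rootSmall_integral_empirical hA1 hA2 hn (S.isBddMeasurable_stat_apply hA1 n j)).abs
  have hle : ∀ (N : ℕ) (h : Hist (fun p => Fin N → E p) n), ‖S.thetaN n h.last - S.theta n‖
      ≤ ∑ j, |S.thetaN n h.last j - S.theta n j| := fun _ h => norm_le_sum_abs _
  have hb : BddSeq (fun N (h : Hist (fun p => Fin N → E p) n) =>
      ‖S.thetaN n h.last - S.theta n‖) := by
    obtain ⟨C, hC⟩ := hs.1
    refine ⟨C, fun N hN => ⟨(((S.measurable_thetaN n).comp Hist.measurable_last).sub_const _).norm,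
      fun h => ?_⟩⟩
    rw [abs_norm]
    exact (hle N h).trans ((le_abs_self _).trans ((hC N hN).2 h))
  refine hs.of_abs_le hb (K := 1) fun N hN h => ?_
  rw [abs_norm, one_mul]
  exact (hle N h).trans (le_abs_self _)

/-- Replacing θ^N by θ costs at most a Lipschitz constant times ‖θ^N - θ‖; the rest is the law of
large numbers for Q_θ φ. -/
theorem rootSmall_prediction (S : AdaptiveSMC d E) (hA1 : S.A1) (hA2 : S.A2) {n : ℕ}
    (hn : S.MeanSquareLLN n) {φ : E (n + 1) → ℝ} (hφ : IsBddMeasurable φ) :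
    RootSmall (fun N => S.smcLaw N n)
      (fun N h => S.gammaN N n (S.Q n (S.thetaN n h.last) φ) h
        - ∫ x, φ x ∂(S.gamma (n + 1))) := by
  have := fun N => S.isProbabilityMeasure_smcLaw hA1 hA2 N n
  have hQb := S.isBddMeasurable_Q_theta hA1 n hφ
  obtain ⟨C, hC0, hC⟩ := S.exists_abs_Q_sub_le hA1 hA2 n (S.theta_mem_closure hA1 n) hφ
  have h1 : RootSmall (fun N => S.smcLaw N n)
      (fun N h => ∫ z, S.Q n (S.thetaN n h.last) φ z ∂(empirical h.last)
        - ∫ z, S.Q n (S.theta n) φ z ∂(empirical h.last)) := by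
    refine (S.rootSmall_thetaN hA1 hA2 hn).of_abs_le
      ((S.bddSeq_integral_Q_thetaN hA1 hA2 n hφ).sub (bddSeq_integral_empirical n hQb)) (K := C)
      fun N hN h => ?_
    have hm := S.measurable_Q n (S.thetaN n h.last) hφ.1
    have hd := integral_empirical_real h.last (hm.sub hQb.1)
    simp only [Pi.sub_apply] at hd
    rw [integral_empirical_real _ hm, integral_empirical_real _ hQb.1, ← mul_sub,
      ← Finset.sum_sub_distrib, ← hd, abs_norm]
    exact abs_integral_empirical_le hN _ fun x => hC x _ (S.thetaN_mem hN n _)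
  have h2 := (RootSmall.bdd_mul (S.bddSeq_prodGN hA1 hA2 n) h1).add (hn _ hQb)
  refine h2.of_abs_le ((S.bddSeq_gammaN_Q_thetaN hA1 hA2 n hφ).sub (BddSeq.const _)) (K := 1)
    fun _ _ h => ?_
  rw [S.integral_gamma_succ hA1 n hφ, one_mul]
  apply le_of_eq
  congr 1
  simp only [gammaN]
  ring

theorem RootSmall.lift (S : AdaptiveSMC d E) (hA1 : S.A1) (hA2 : S.A2) {n : ℕ}
    {Z : ∀ N, Hist (fun p => Fin N → E p) n → ℝ} (hZ : RootSmall (fun N => S.smcLaw N n) Z) :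
    RootSmall (fun N => S.smcLaw N (n + 1)) (fun N h => Z N h.1) := by
  have := fun N => S.isProbabilityMeasure_smcLaw hA1 hA2 N n
  obtain ⟨⟨B, hB⟩, C, hC⟩ := hZ
  have hfst : ∀ N, Measurable
      (fun h : Hist (fun p => Fin N → E p) (n + 1) => h.1) := fun N => measurable_fst
  refine ⟨⟨B, fun N hN => ⟨(hB N hN).1.comp (hfst N), fun h => (hB N hN).2 h.1⟩⟩, C, fun N hN => ?_⟩
  refine (S.integral_smcLaw_succ hA1 hA2 N n (f := fun h => Z N h.1 ^ 2)
    (((hB N hN).1.comp (hfst N)).pow_const 2) (C := B ^ 2)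
    (fun h => by rw [Real.norm_eq_abs, abs_pow]; gcongr; exact (hB N hN).2 h.1)).trans_le ?_
  have hp := fun h : Hist (fun p => Fin N → E p) n => S.isProbabilityMeasure_PhiN hA1 hN n h.last
  simpa using hC N hN

theorem bddSeq_fluctuation (S : AdaptiveSMC d E) (hA1 : S.A1) (hA2 : S.A2) (n : ℕ)
    {φ : E (n + 1) → ℝ} (hφ : IsBddMeasurable φ) :
    BddSeq fun N (h : Hist (fun p => Fin N → E p) (n + 1)) =>
      S.gammaN N (n + 1) φ h - S.gammaN N n (S.Q n (S.thetaN n h.1.last) φ) h.1 := by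
  refine (S.bddSeq_gammaN hA1 hA2 (n + 1) hφ).sub ?_
  obtain ⟨C, hC⟩ := S.bddSeq_gammaN_Q_thetaN hA1 hA2 n hφ
  have hfst : ∀ N, Measurable
      (fun h : Hist (fun p => Fin N → E p) (n + 1) => h.1) := fun N => measurable_fst
  exact ⟨C, fun N hN => ⟨(hC N hN).1.comp (hfst N), fun h => (hC N hN).2 h.1⟩⟩

theorem fluctuation_eq (S : AdaptiveSMC d E) (hA1 : S.A1) {N : ℕ} (hN : 0 < N) (n : ℕ)
    {φ : E (n + 1) → ℝ} (hφ : IsBddMeasurable φ)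
    (h : Hist (fun p => Fin N → E p) n) (x : Fin N → E (n + 1)) :
    S.gammaN N (n + 1) φ (h, x) - S.gammaN N n (S.Q n (S.thetaN n h.last) φ) h =
      S.prodGN N (n + 1) (h, x) *
        (∫ z, φ z ∂(empirical x) - ∫ z, φ z ∂(S.PhiN n h.last)) := by
  rw [mul_sub, S.prodGN_mul_integral_PhiN hA1 hN n h x hφ]
  rfl

/-- Given the history this is a bounded factor times a centred average of N i.i.d. bounded
variables. -/
theorem rootSmall_fluctuation (S : AdaptiveSMC d E) (hA1 : S.A1) (hA2 : S.A2) (n : ℕ)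
    {φ : E (n + 1) → ℝ} (hφ : IsBddMeasurable φ) :
    RootSmall (fun N => S.smcLaw N (n + 1)) (fun N h =>
      S.gammaN N (n + 1) φ h - S.gammaN N n (S.Q n (S.thetaN n h.1.last) φ) h.1) := by
  have hb := S.bddSeq_fluctuation hA1 hA2 n hφ
  have hb' := hb
  obtain ⟨B, hB⟩ := hb'
  obtain ⟨C, hC0, hC⟩ := S.exists_prodGN_le hA1 (n + 1)
  obtain ⟨hm, K, hK⟩ := id hφ
  refine ⟨hb, C ^ 2 * (2 * K) ^ 2, fun N hN => ?_⟩
  have := S.isProbabilityMeasure_smcLaw hA1 hA2 N n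
  have hp := fun h : Hist (fun p => Fin N → E p) n => S.isProbabilityMeasure_PhiN hA1 hN n h.last
  rw [S.integral_smcLaw_succ hA1 hA2 N n ((hB N hN).1.pow_const 2) (C := B ^ 2)
    (fun h => by rw [Real.norm_eq_abs, abs_pow]; gcongr; exact (hB N hN).2 h)]
  have key : ∀ h : Hist (fun p => Fin N → E p) n,
      ∫ x, (S.gammaN N (n + 1) φ (h, x) - S.gammaN N n (S.Q n (S.thetaN n h.last) φ) h) ^ 2
        ∂(Measure.pi fun _ : Fin N => S.PhiN n h.last) ≤ C ^ 2 * (2 * K) ^ 2 / N := fun h => by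
    simp_rw [S.fluctuation_eq hA1 hN n hφ, mul_pow _ _ 2, prodGN_succ]
    rw [integral_const_mul, mul_div_assoc]
    -- The product of potentials at time n + 1 ignores the newest generation, so an arbitrary one is
    -- inserted to use its bounds.
    have hc := hC N hN (h, fun _ => (nonempty_of_isProbabilityMeasure (S.PhiN n h.last)).some)
    have hpos := S.prodGN_pos hA1 hN (n + 1)
      (h, fun _ => (nonempty_of_isProbabilityMeasure (S.PhiN n h.last)).some)
    rw [prodGN_succ] at hc hpos
    have := integral_pi_sq_empirical_sub_le (S.PhiN n h.last) hm hK hN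
    rw [mul_pow] at this
    gcongr
  have hl := integral_mono_of_nonneg (μ := S.smcLaw N n)
    (Eventually.of_forall fun h => integral_nonneg fun x => sq_nonneg _)
    (integrable_const (C ^ 2 * (2 * K) ^ 2 / N)) (Eventually.of_forall key)
  simpa using hl

theorem meanSquareLLN (S : AdaptiveSMC d E) (hA1 : S.A1) (hA2 : S.A2) (n : ℕ) :
    S.MeanSquareLLN n := by
  induction n with
  | zero =>
    intro φ hφ
    refine ⟨(S.bddSeq_gammaN hA1 hA2 0 hφ).sub (BddSeq.const _), ?_⟩
    obtain ⟨hm, K, hK⟩ := hφ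
    refine ⟨(2 * K) ^ 2, fun N hN => ?_⟩
    have := integral_pi_sq_empirical_sub_le S.init hm hK hN
    rw [gamma_zero]
    simp only [gammaN, prodGN, one_mul]
    exact this
  | succ n ih =>
    intro φ hφ
    have := fun N => S.isProbabilityMeasure_smcLaw hA1 hA2 N (n + 1)
    have h := (S.rootSmall_fluctuation hA1 hA2 n hφ).add
      (RootSmall.lift S hA1 hA2 (S.rootSmall_prediction hA1 hA2 ih hφ))
    simpa using h

end AdaptiveSMC

/-! ### Remainders negligible at scale √N, and the linearisation through 𝓛. -/

theorem tendsto_const_div_sqrt (C : ℝ) : Tendsto (fun N : ℕ => C / √(N : ℝ)) atTop (𝓝 0) :=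
  tendsto_const_nhds.div_atTop (Real.tendsto_sqrt_atTop.comp tendsto_natCast_atTop_atTop)

/-- A sequence that is, up to an arbitrarily small linear term, quadratic in small sequences is
negligible at scale `√N`. -/
theorem RootSmall.tendsto_sqrt_mul_integral_abs {Ω : ℕ → Type*} [∀ N, MeasurableSpace (Ω N)]
    {P : ∀ N, Measure (Ω N)} [∀ N, IsProbabilityMeasure (P N)] {Y B Z : ∀ N, Ω N → ℝ}
    (hY : RootSmall P Y) (hB : RootSmall P B) (hZ : BddSeq Z) {C : ℝ} (hC : 0 ≤ C)
    (h : ∀ ε > 0, ∃ K, 0 ≤ K ∧ ∀ N, 0 < N → ∀ ω,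
      |Z N ω| ≤ C * ((ε + K * |Y N ω|) * |Y N ω| + |Y N ω * B N ω|)) :
    Tendsto (fun N : ℕ => √(N : ℝ) * ∫ ω, |Z N ω| ∂(P N)) atTop (𝓝 0) := by
  obtain ⟨C1, hC1⟩ := hY.integral_abs_le
  obtain ⟨C2, hC2⟩ := hY.integral_abs_mul_le hY
  obtain ⟨C3, hC3⟩ := hY.integral_abs_mul_le hB
  rw [Metric.tendsto_nhds]
  intro η hη
  have hM : 0 < C * |C1| + 1 := by positivity
  -- As √N E|Y| ≤ C1, the linear term contributes at most C ε |C1| ≤ η/2. The quadratic terms have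
  -- mean O(1/N) and vanish after multiplication by √N.
  set ε := η / (2 * (C * |C1| + 1)) with hε
  have hε0 : 0 < ε := by positivity
  obtain ⟨K, hK0, hK⟩ := h ε hε0
  have hsmall : ∀ᶠ N : ℕ in atTop, C * (K * C2 + C3) / √(N : ℝ) < η / 2 :=
    (tendsto_const_div_sqrt _).eventually_lt_const (by positivity)
  filter_upwards [hsmall, eventually_gt_atTop 0] with N hN1 hN
  have hN' : (0 : ℝ) < N := by exact_mod_cast hN
  have hs0 : 0 < √(N : ℝ) := Real.sqrt_pos.2 hN'
  have i1 := hY.1.abs.integrable (P := P) hN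
  have i2 := (hY.1.mul hY.1).abs.integrable (P := P) hN
  have i3 := (hY.1.mul hB.1).abs.integrable (P := P) hN
  have i12 : Integrable (fun ω => ε * |Y N ω| + K * |Y N ω * Y N ω|) (P N) :=
    (i1.const_mul ε).add (i2.const_mul K)
  have hint : ∫ ω, |Z N ω| ∂(P N) ≤ C * (ε * ∫ ω, |Y N ω| ∂(P N)
      + K * ∫ ω, |Y N ω * Y N ω| ∂(P N) + ∫ ω, |Y N ω * B N ω| ∂(P N)) := by
    rw [← integral_const_mul ε, ← integral_const_mul K,
      ← integral_add (i1.const_mul ε) (i2.const_mul K),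
      ← integral_add i12 i3, ← integral_const_mul]
    refine integral_mono (hZ.abs.integrable hN)
      ((i12.add i3).const_mul C) fun ω => ?_
    refine (hK N hN ω).trans (le_of_eq ?_)
    rw [abs_mul (Y N ω) (Y N ω)]
    ring
  have hnn : 0 ≤ √(N : ℝ) * ∫ ω, |Z N ω| ∂(P N) :=
    mul_nonneg hs0.le (integral_nonneg fun _ => abs_nonneg _)
  rw [Real.dist_eq, sub_zero, abs_of_nonneg hnn]
  have hsN : √(N : ℝ) * (K * C2 / N + C3 / N) = (K * C2 + C3) / √(N : ℝ) := by
    have hs : √(N : ℝ) * √(N : ℝ) = N := Real.mul_self_sqrt hN'.le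
    rw [← add_div, eq_div_iff hs0.ne']
    calc √(N : ℝ) * ((K * C2 + C3) / N) * √(N : ℝ)
        = (√(N : ℝ) * √(N : ℝ)) * ((K * C2 + C3) / N) := by ring
      _ = _ := by rw [hs]; field_simp
  calc √(N : ℝ) * ∫ ω, |Z N ω| ∂(P N)
      ≤ √(N : ℝ) * (C * (ε * ∫ ω, |Y N ω| ∂(P N) + K * (C2 / N) + C3 / N)) := by
        refine mul_le_mul_of_nonneg_left (hint.trans ?_) hs0.le
        have := hC2 N hN
        have := hC3 N hN
        gcongr
    _ = C * (ε * (√(N : ℝ) * ∫ ω, |Y N ω| ∂(P N))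
          + √(N : ℝ) * (K * C2 / N + C3 / N)) := by ring
    _ ≤ C * (ε * |C1| + (K * C2 + C3) / √(N : ℝ)) := by
        rw [hsN]
        have := (hC1 N hN).trans (le_abs_self C1)
        gcongr
    _ = ε * (C * |C1|) + C * (K * C2 + C3) / √(N : ℝ) := by ring
    _ < η / 2 + η / 2 := by
        refine add_lt_add_of_le_of_lt ?_ hN1
        have : ε * (C * |C1| + 1) = η / 2 := by rw [hε]; field_simp
        nlinarith
    _ = η := by ring

/-- The exponential is 1-Lipschitz on the nonpositive half-line. -/
theorem abs_exp_neg_half_sub_le {x y t : ℝ} (hx : 0 ≤ x) (hy : 0 ≤ y) :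
    |Real.exp (-(t ^ 2 * x) / 2) - Real.exp (-(t ^ 2 * y) / 2)| ≤ t ^ 2 / 2 * |x - y| := by
  have main : ∀ a b : ℝ, a ≤ 0 → b ≤ a → |Real.exp a - Real.exp b| ≤ a - b := fun a b ha hb => by
    rw [abs_of_nonneg (sub_nonneg.2 (Real.exp_le_exp.2 hb))]
    have h1 : Real.exp b = Real.exp a * Real.exp (b - a) := by rw [← Real.exp_add]; ring_nf
    have h2 := Real.add_one_le_exp (b - a)
    have h3 : Real.exp a ≤ 1 := Real.exp_le_one_iff.2 ha
    have h4 := Real.exp_pos a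
    rw [h1]
    nlinarith
  have ht := sq_nonneg t
  have e : ∀ z : ℝ, 0 ≤ z → -(t ^ 2 * z) / 2 ≤ 0 := fun z hz => by
    have := mul_nonneg ht hz
    linarith
  rcases le_total x y with h | h
  · have hm := mul_le_mul_of_nonneg_left h ht
    refine (main _ _ (e x hx) (by linarith)).trans (le_of_eq ?_)
    rw [abs_of_nonpos (by linarith)]; ring
  · have hm := mul_le_mul_of_nonneg_left h ht
    rw [abs_sub_comm]
    refine (main _ _ (e y hy) (by linarith)).trans (le_of_eq ?_)
    rw [abs_of_nonneg (by linarith)]; ring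

namespace AdaptiveSMC

variable {d : ℕ} {E : ℕ → Type*} [∀ n, MeasurableSpace (E n)]

/-- Quantitative central limit theorem for the characteristic function of the fluctuations of an
empirical measure. -/
theorem norm_integral_pi_cexp_empirical_sub_le {X : Type*} [MeasurableSpace X] (ν : Measure X)
    [IsProbabilityMeasure ν] {φ : X → ℝ} (hm : Measurable φ) {K : ℝ} (hK : ∀ x, |φ x| ≤ K)
    {N : ℕ} (hN : 0 < N) {g G₀ : ℝ} (hg0 : 0 ≤ g) (hg : g ≤ G₀) (t : ℝ) :
    ‖∫ x : Fin N → X, Complex.exp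
        (((t * (√(N : ℝ) * (g * (∫ z, φ z ∂(empirical x) - ∫ z, φ z ∂ν))) : ℝ) : ℂ) * Complex.I)
        ∂(Measure.pi fun _ => ν)
      - ((Real.exp (-(t ^ 2 * (g ^ 2 * Var[φ; ν])) / 2) : ℝ) : ℂ)‖
    ≤ (|t| * G₀) ^ 3 * ((2 * K) ^ 3 * Real.exp (|t| * G₀ * (2 * K)) +
        |t| * G₀ * (2 * K) ^ 4 * Real.exp ((|t| * G₀) ^ 2 * (2 * K) ^ 2)) / √(N : ℝ) := by
  have hN' : (0 : ℝ) < N := by exact_mod_cast hN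
  have hs0 : 0 < √(N : ℝ) := Real.sqrt_pos.2 hN'
  have hs : √(N : ℝ) ^ 2 = N := Real.sq_sqrt hN'.le
  have hs1 : 1 ≤ √(N : ℝ) := Real.one_le_sqrt.2 (by exact_mod_cast hN)
  have hne : Nonempty X := nonempty_of_isProbabilityMeasure ν
  have hK0 : 0 ≤ K := (abs_nonneg _).trans (hK hne.some)
  have hG0 : 0 ≤ G₀ := hg0.trans hg
  have habs : |t * g / √(N : ℝ)| = |t| * g / √(N : ℝ) := by
    rw [abs_div, abs_mul, abs_of_nonneg hg0, abs_of_pos hs0]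
  have hle : |t * g / √(N : ℝ)| ≤ |t| * G₀ := by
    rw [habs]
    refine (div_le_self (by positivity) hs1).trans ?_
    gcongr
  -- Applied at frequency s = t g/√N, which |t| G₀ dominates because √N ≥ 1; the constants then do
  -- not depend on N or g.
  have key := norm_integral_pi_cexp_sub_gaussian_le (ν := ν) (N := N) (hm.sub_const (∫ z, φ z ∂ν))
    (abs_sub_integral_le ν hK) (integral_sub_integral_eq_zero ν ⟨hm, K, hK⟩) hle
  have e1 : ∀ x : Fin N → X, t * (√(N : ℝ) * (g * (∫ z, φ z ∂(empirical x) - ∫ z, φ z ∂ν)))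
      = t * g / √(N : ℝ) * ∑ i, (φ (x i) - ∫ z, φ z ∂ν) := fun x => by
    rw [integral_empirical_sub_const hN _ hm]
    field_simp
    rw [hs]
    ring
  have e2 : N * (t * g / √(N : ℝ)) ^ 2 * ∫ x, (φ x - ∫ z, φ z ∂ν) ^ 2 ∂ν
      = t ^ 2 * (g ^ 2 * Var[φ; ν]) := by
    rw [variance_eq_integral hm.aemeasurable, div_pow, hs]
    field_simp
  rw [e2] at key
  simp_rw [e1]
  refine key.trans ?_
  rw [habs, div_pow, ← mul_assoc, mul_div_right_comm _ _ (√(N : ℝ))]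
  gcongr ?_ * _
  calc (N : ℝ) * ((|t| * g) ^ 3 / √(N : ℝ) ^ 3)
      = (|t| * g) ^ 3 / √(N : ℝ) := by
        rw [pow_succ (√(N : ℝ)) 2, hs]; field_simp
    _ ≤ _ := by gcongr

/-- The correction term of 𝓛 has mean zero under η_n. Thus both errors in the induction step are
centred at the same constant. -/
theorem integral_L_gamma (S : AdaptiveSMC d E) (hA1 : S.A1) (hA2 : S.A2) (n : ℕ)
    {φ : E (n + 1) → ℝ} (hφ : IsBddMeasurable φ) :
    ∫ x, S.L n φ x ∂(S.gamma n) = ∫ y, φ y ∂(S.gamma (n + 1)) := by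
  have := S.isProbabilityMeasure_eta hA1 n
  obtain ⟨hQm, C, hC⟩ := S.isBddMeasurable_Q_theta hA1 n hφ
  have hi : ∀ j, Integrable (fun x => S.stat n x j) (S.eta n) := fun j => by
    obtain ⟨h1, C, hC⟩ := S.isBddMeasurable_stat_apply hA1 n j
    exact integrable_of_measurable_bdd h1 hC
  have hi' : ∀ j ∈ Finset.univ, Integrable (fun x => (S.stat n x j - S.theta n j) *
      ∫ z, S.dQcoord n φ j z ∂(S.eta n)) (S.eta n) := fun j _ =>
    ((hi j).sub (integrable_const _)).mul_const _
  rw [S.integral_gamma_succ hA1 n hφ, S.integral_gamma hA1, S.integral_gamma hA1]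
  simp_rw [S.L_eq hA1 hA2 n hφ]
  rw [integral_add (integrable_finsetSum _ hi') (integrable_of_measurable_bdd hQm hC),
    integral_finsetSum _ hi']
  have hz : ∀ j, ∫ x, (S.stat n x j - S.theta n j) *
      (∫ z, S.dQcoord n φ j z ∂(S.eta n)) ∂(S.eta n) = 0 := fun j => by
    rw [integral_mul_const, integral_sub (hi j) (integrable_const _), ← S.theta_apply hA1]
    simp
  simp [hz]

/-- An exact splitting into the averaged Taylor remainder and a second-order term, the product of
the errors of θ^N and of η_n^N(∂Qφ). -/
theorem integral_empirical_Q_sub_L (S : AdaptiveSMC d E) (hA1 : S.A1) (hA2 : S.A2) {N : ℕ}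
    (hN : 0 < N) (n : ℕ) {φ : E (n + 1) → ℝ} (hφ : IsBddMeasurable φ) (x : Fin N → E n) :
    ∫ z, S.Q n (S.thetaN n x) φ z ∂(empirical x) - ∫ z, S.L n φ z ∂(empirical x) =
      (N : ℝ)⁻¹ * ∑ i, (S.Q n (S.thetaN n x) φ (x i) - S.Q n (S.theta n) φ (x i)
        - S.dQ n (S.theta n) φ (x i) (S.thetaN n x - S.theta n))
      + ∑ j, (S.thetaN n x j - S.theta n j) *
        (∫ z, S.dQcoord n φ j z ∂(empirical x) - ∫ z, S.dQcoord n φ j z ∂(S.eta n)) := by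
  have hQ := S.isBddMeasurable_Q_theta hA1 n hφ
  have hD := fun j => S.isBddMeasurable_dQcoord hA1 hA2 n hφ j
  have hL := S.isBddMeasurable_L hA1 hA2 n hφ
  have hst : ∀ j, S.thetaN n x j - S.theta n j
      = (N : ℝ)⁻¹ * ∑ i, (S.stat n (x i) j - S.theta n j) := fun j => by
    rw [thetaN_apply, integral_empirical_sub_const hN x (S.measurable_stat_apply n j)]
  have h1 : (N : ℝ)⁻¹ * ∑ i, S.L n φ (x i) =
      ∑ j, (S.thetaN n x j - S.theta n j) * (∫ z, S.dQcoord n φ j z ∂(S.eta n))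
        + (N : ℝ)⁻¹ * ∑ i, S.Q n (S.theta n) φ (x i) := by
    simp_rw [S.L_eq hA1 hA2 n hφ, Finset.sum_add_distrib, mul_add, hst]
    congr 1
    rw [Finset.sum_comm, Finset.mul_sum]
    refine Finset.sum_congr rfl fun j _ => ?_
    rw [← Finset.sum_mul, mul_assoc]
  have h2 : (N : ℝ)⁻¹ * ∑ i, S.dQ n (S.theta n) φ (x i) (S.thetaN n x - S.theta n)
      = ∑ j, (S.thetaN n x j - S.theta n j) * ∫ z, S.dQcoord n φ j z ∂(empirical x) := by
    simp_rw [clm_apply_eq_sum _ (S.thetaN n x - S.theta n), integral_empirical_real x (hD _).1]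
    rw [Finset.sum_comm, Finset.mul_sum]
    refine Finset.sum_congr rfl fun j _ => ?_
    rw [← Finset.mul_sum]
    simp only [PiLp.sub_apply, dQcoord]
    ring
  rw [integral_empirical_real x (S.measurable_Q n _ hφ.1), integral_empirical_real x hL.1, h1]
  simp_rw [Finset.sum_sub_distrib, mul_sub, Finset.sum_sub_distrib]
  rw [h2]
  ring

/-- The prediction error linearises through the operator `𝓛`, up to `o(1 / √N)`. -/
theorem tendsto_sqrt_mul_integral_remainder (S : AdaptiveSMC d E) (hA1 : S.A1) (hA2 : S.A2)
    (n : ℕ) {φ : E (n + 1) → ℝ} (hφ : IsBddMeasurable φ) :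
    Tendsto (fun N : ℕ => √(N : ℝ) * ∫ h, |S.gammaN N n (S.Q n (S.thetaN n h.last) φ) h
      - S.gammaN N n (S.L n φ) h| ∂(S.smcLaw N n)) atTop (𝓝 0) := by
  have := fun N => S.isProbabilityMeasure_smcLaw hA1 hA2 N n
  have hn := S.meanSquareLLN hA1 hA2 n
  obtain ⟨C, hC0, hC⟩ := S.exists_prodGN_le hA1 n
  have hB : RootSmall (fun N => S.smcLaw N n) (fun N h =>
      ∑ j, |∫ z, S.dQcoord n φ j z ∂(empirical h.last) - ∫ z, S.dQcoord n φ j z ∂(S.eta n)|) :=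
    RootSmall.sum _ fun j => (S.rootSmall_integral_empirical hA1 hA2 hn
      (S.isBddMeasurable_dQcoord hA1 hA2 n hφ j)).abs
  refine RootSmall.tendsto_sqrt_mul_integral_abs (P := fun N => S.smcLaw N n)
    (Z := fun N h => S.gammaN N n (S.Q n (S.thetaN n h.last) φ) h - S.gammaN N n (S.L n φ) h)
    (S.rootSmall_thetaN hA1 hA2 hn) hB
    ((S.bddSeq_gammaN_Q_thetaN hA1 hA2 n hφ).sub
      (S.bddSeq_gammaN hA1 hA2 n (S.isBddMeasurable_L hA1 hA2 n hφ))) hC0 fun ε hε => ?_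
  obtain ⟨K, hK0, hK⟩ := S.exists_abs_Q_sub_sub_le hA1 hA2 n (S.theta_mem_closure hA1 n) hφ hε
  refine ⟨K, hK0, fun N hN h => ?_⟩
  have hN' : (0 : ℝ) < N := by exact_mod_cast hN
  simp only [gammaN]
  rw [← mul_sub, abs_mul, abs_of_pos (S.prodGN_pos hA1 hN n h),
    S.integral_empirical_Q_sub_L hA1 hA2 hN n hφ]
  refine mul_le_mul (hC N hN h) ((abs_add_le _ _).trans (add_le_add ?_ ?_)) (abs_nonneg _) hC0
  · rw [abs_norm, abs_mul, abs_inv, Nat.abs_cast, inv_mul_le_iff₀ hN']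
    refine (Finset.abs_sum_le_sum_abs _ _).trans ?_
    refine (Finset.sum_le_sum fun i _ => hK (h.last i) _ (S.thetaN_mem hN n h.last)).trans ?_
    simp
  · have hnn : 0 ≤ ∑ j, |∫ z, S.dQcoord n φ j z ∂(empirical h.last)
        - ∫ z, S.dQcoord n φ j z ∂(S.eta n)| := Finset.sum_nonneg fun j _ => abs_nonneg _
    rw [abs_mul, abs_norm, abs_of_nonneg hnn, Finset.mul_sum]
    refine (Finset.abs_sum_le_sum_abs _ _).trans (Finset.sum_le_sum fun j _ => ?_)
    rw [abs_mul]
    gcongr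
    exact abs_apply_le_norm (S.thetaN n h.last - S.theta n) j

/-! ### The central limit theorem by induction on time. -/

/-- The asymptotic variance of `√N (γ_n^N(φ) - γ_n(φ))`, in recursive form. -/
noncomputable def cltVar (S : AdaptiveSMC d E) : ∀ n, (E n → ℝ) → ℝ
  | 0, φ => (S.gamma 0).real Set.univ ^ 2 * Var[φ; S.eta 0]
  | n + 1, φ => (S.gamma (n + 1)).real Set.univ ^ 2 * Var[φ; S.eta (n + 1)]
      + cltVar S n (S.L n φ)

/-- Convergence of the characteristic functions of `√N (γ_n^N(φ) - γ_n(φ))`. -/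
def CharFunCLT (S : AdaptiveSMC d E) (n : ℕ) : Prop :=
  ∀ φ : E n → ℝ, IsBddMeasurable φ → ∀ t : ℝ, Tendsto (fun N : ℕ =>
    ∫ h, Complex.exp (((t * (√(N : ℝ) * (S.gammaN N n φ h - ∫ x, φ x ∂(S.gamma n))) : ℝ) : ℂ)
      * Complex.I) ∂(S.smcLaw N n)) atTop
    (𝓝 ((Real.exp (-(t ^ 2 * S.cltVar n φ) / 2) : ℝ) : ℂ))

theorem isBddMeasurable_sq {X : Type*} [MeasurableSpace X] {φ : X → ℝ} (hφ : IsBddMeasurable φ) :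
    IsBddMeasurable fun x => φ x ^ 2 := by
  obtain ⟨hm, K, hK⟩ := hφ
  exact ⟨hm.pow_const 2, K ^ 2, fun x => by rw [abs_pow]; gcongr; exact hK x⟩

theorem variance_eq_of_isBddMeasurable {X : Type*} [MeasurableSpace X] (ν : Measure X)
    [IsProbabilityMeasure ν] {φ : X → ℝ} (hφ : IsBddMeasurable φ) :
    Var[φ; ν] = ∫ x, φ x ^ 2 ∂ν - (∫ x, φ x ∂ν) ^ 2 := by
  obtain ⟨hm, K, hK⟩ := hφ
  rw [variance_eq_sub (MemLp.of_bound hm.aestronglyMeasurable K (Eventually.of_forall hK))]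
  rfl

theorem eta_zero (S : AdaptiveSMC d E) : S.eta 0 = S.init := by
  rw [eta, normalise, gamma_zero]
  simp

theorem charFunCLT_zero (S : AdaptiveSMC d E) : S.CharFunCLT 0 := by
  intro φ hφ t
  obtain ⟨hm, K, hK⟩ := hφ
  rw [tendsto_iff_norm_sub_tendsto_zero]
  refine squeeze_zero' (Eventually.of_forall fun N => norm_nonneg _) ?_
    (tendsto_const_div_sqrt ((|t| * 1) ^ 3 * ((2 * K) ^ 3 * Real.exp (|t| * 1 * (2 * K)) +
        |t| * 1 * (2 * K) ^ 4 * Real.exp ((|t| * 1) ^ 2 * (2 * K) ^ 2))))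
  filter_upwards [eventually_gt_atTop 0] with N hN
  have := norm_integral_pi_cexp_empirical_sub_le S.init hm hK hN zero_le_one le_rfl t
  simp only [cltVar, eta_zero, gammaN, prodGN]
  rw [gamma_zero, probReal_univ]
  simp only [one_mul] at this ⊢
  exact this

/-- The limiting conditional variance of the fluctuations produced in one step. -/
theorem rootSmall_conditional_variance (S : AdaptiveSMC d E) (hA1 : S.A1) (hA2 : S.A2) (n : ℕ)
    {φ : E (n + 1) → ℝ} (hφ : IsBddMeasurable φ) :
    RootSmall (fun N => S.smcLaw N n) fun N h =>
      (S.gammaN N n (S.Q n (S.thetaN n h.last) fun _ => 1) h *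
          S.gammaN N n (S.Q n (S.thetaN n h.last) fun x => φ x ^ 2) h
        - S.gammaN N n (S.Q n (S.thetaN n h.last) φ) h ^ 2)
      - (S.gamma (n + 1)).real Set.univ ^ 2 * Var[φ; S.eta (n + 1)] := by
  have := fun N => S.isProbabilityMeasure_smcLaw hA1 hA2 N n
  have := S.isProbabilityMeasure_eta hA1 (n + 1)
  have hn := S.meanSquareLLN hA1 hA2 n
  have h1 := isBddMeasurable_const (X := E (n + 1)) 1
  have b1 := S.bddSeq_gammaN_Q_thetaN hA1 hA2 n (isBddMeasurable_sq hφ)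
  have r1 := S.rootSmall_prediction hA1 hA2 hn h1
  have r2 := S.rootSmall_prediction hA1 hA2 hn (isBddMeasurable_sq hφ)
  have r3 := S.rootSmall_prediction hA1 hA2 hn hφ
  have b3 := (S.bddSeq_gammaN_Q_thetaN hA1 hA2 n hφ).add
    (BddSeq.const (∫ x, φ x ∂(S.gamma (n + 1))))
  have hv : (S.gamma (n + 1)).real Set.univ ^ 2 * Var[φ; S.eta (n + 1)]
      = (∫ _, (1 : ℝ) ∂(S.gamma (n + 1))) * ∫ x, φ x ^ 2 ∂(S.gamma (n + 1))
        - (∫ x, φ x ∂(S.gamma (n + 1))) ^ 2 := by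
    rw [variance_eq_of_isBddMeasurable _ hφ, S.integral_gamma hA1 (n + 1) fun x => φ x ^ 2,
      S.integral_gamma hA1 (n + 1) φ]
    simp only [integral_const, smul_eq_mul]
    ring
  -- Telescoping: ab - a₀b₀ = b(a - a₀) + a₀(b - b₀) and r² - c² = (r + c)(r - c), each with a
  -- bounded and a small factor.
  have key := ((RootSmall.bdd_mul b1 r1).add (RootSmall.bdd_mul
    (BddSeq.const (∫ _, (1 : ℝ) ∂(S.gamma (n + 1)))) r2)).add
    (RootSmall.bdd_mul (BddSeq.const (-1)) (RootSmall.bdd_mul b3 r3))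
  rw [hv]
  convert key using 3 with N h
  ring

theorem prodGN_succ_eq_gammaN (S : AdaptiveSMC d E) {N : ℕ} (n : ℕ)
    (h : Hist (fun p => Fin N → E p) n) :
    S.prodGN N n h * ∫ z, S.G n (S.thetaN n h.last) z ∂(empirical h.last)
      = S.gammaN N n (S.Q n (S.thetaN n h.last) fun _ => 1) h := by
  simp only [gammaN, Q_one]

/-- Multiplying by the squared normaliser makes the conditional variance a polynomial in
unnormalised conditional means, whose limits are known. -/
theorem sq_mul_variance_PhiN (S : AdaptiveSMC d E) (hA1 : S.A1) {N : ℕ} (hN : 0 < N) (n : ℕ)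
    {φ : E (n + 1) → ℝ} (hφ : IsBddMeasurable φ) (h : Hist (fun p => Fin N → E p) n) :
    S.gammaN N n (S.Q n (S.thetaN n h.last) fun _ => 1) h ^ 2 * Var[φ; S.PhiN n h.last] =
      S.gammaN N n (S.Q n (S.thetaN n h.last) fun _ => 1) h *
          S.gammaN N n (S.Q n (S.thetaN n h.last) fun x => φ x ^ 2) h
        - S.gammaN N n (S.Q n (S.thetaN n h.last) φ) h ^ 2 := by
  have := S.isProbabilityMeasure_PhiN hA1 hN n h.last
  have x : Fin N → E (n + 1) :=
    fun _ => (nonempty_of_isProbabilityMeasure (S.PhiN n h.last)).some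
  have h1 := S.prodGN_mul_integral_PhiN hA1 hN n h x hφ
  have h2 := S.prodGN_mul_integral_PhiN hA1 hN n h x (isBddMeasurable_sq hφ)
  rw [prodGN_succ, prodGN_succ_eq_gammaN] at h1 h2
  rw [variance_eq_of_isBddMeasurable _ hφ, ← h1, ← h2]
  ring

/-- Holds for every history. The three terms are the conditional Gaussian approximation, the
replacement of the conditional variance by its limit, and the replacement of R by γ_n^N(𝓛φ); each
tends to zero once averaged over histories. -/
theorem charFunCLT_step_bound (S : AdaptiveSMC d E) (hA1 : S.A1) (hA2 : S.A2) (n : ℕ)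
    {φ : E (n + 1) → ℝ} (hφ : IsBddMeasurable φ) (t : ℝ) :
    ∃ C : ℝ, ∀ N : ℕ, 0 < N → ∀ h : Hist (fun p => Fin N → E p) n,
      ‖∫ x, (Complex.exp (((t * (√(N : ℝ) * (S.gammaN N (n + 1) φ (h, x)
            - ∫ y, φ y ∂(S.gamma (n + 1)))) : ℝ) : ℂ) * Complex.I)
          - Complex.exp (((t * (√(N : ℝ) * (S.gammaN N n (S.L n φ) h
            - ∫ y, S.L n φ y ∂(S.gamma n))) : ℝ) : ℂ) * Complex.I)
            * ((Real.exp (-(t ^ 2 * ((S.gamma (n + 1)).real Set.univ ^ 2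
              * Var[φ; S.eta (n + 1)])) / 2) : ℝ) : ℂ))
          ∂(Measure.pi fun _ : Fin N => S.PhiN n h.last)‖
      ≤ C / √(N : ℝ) + t ^ 2 / 2 * |(S.gammaN N n (S.Q n (S.thetaN n h.last) fun _ => 1) h *
            S.gammaN N n (S.Q n (S.thetaN n h.last) fun x => φ x ^ 2) h
          - S.gammaN N n (S.Q n (S.thetaN n h.last) φ) h ^ 2)
          - (S.gamma (n + 1)).real Set.univ ^ 2 * Var[φ; S.eta (n + 1)]|
        + |t| * (√(N : ℝ) * |S.gammaN N n (S.Q n (S.thetaN n h.last) φ) h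
            - S.gammaN N n (S.L n φ) h|) := by
  obtain ⟨G₀, hG0, hG⟩ := S.exists_prodGN_le hA1 (n + 1)
  obtain ⟨hm, K, hK⟩ := id hφ
  refine ⟨(|t| * G₀) ^ 3 * ((2 * K) ^ 3 * Real.exp (|t| * G₀ * (2 * K)) +
        |t| * G₀ * (2 * K) ^ 4 * Real.exp ((|t| * G₀) ^ 2 * (2 * K) ^ 2)), fun N hN h => ?_⟩
  have hp := S.isProbabilityMeasure_PhiN hA1 hN n h.last
  have hs0 : 0 ≤ √(N : ℝ) := Real.sqrt_nonneg _
  rw [S.integral_L_gamma hA1 hA2 n hφ]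
  set g := S.gammaN N n (S.Q n (S.thetaN n h.last) fun _ => 1) h with hg
  set σ := (S.gamma (n + 1)).real Set.univ ^ 2 * Var[φ; S.eta (n + 1)] with hv
  set U := S.gammaN N n (S.L n φ) h with hU
  set c := ∫ y, φ y ∂(S.gamma (n + 1)) with hc
  set R := S.gammaN N n (S.Q n (S.thetaN n h.last) φ) h with hR
  rw [← S.sq_mul_variance_PhiN hA1 hN n hφ h]
  have hv0 : 0 ≤ σ := mul_nonneg (sq_nonneg _) (variance_nonneg _ _)
  let x₀ : Fin N → E (n + 1) :=
    fun _ => (nonempty_of_isProbabilityMeasure (S.PhiN n h.last)).some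
  have hgpos : 0 < g := by
    have := S.prodGN_pos hA1 hN (n + 1) (h, x₀)
    rwa [prodGN_succ, prodGN_succ_eq_gammaN] at this
  have hgle : g ≤ G₀ := by
    have := hG N hN (h, x₀)
    rwa [prodGN_succ, prodGN_succ_eq_gammaN] at this
  have key := norm_integral_pi_cexp_empirical_sub_le (S.PhiN n h.last) hm hK hN hgpos.le hgle t
  have hF : ∀ x, S.gammaN N (n + 1) φ (h, x) - c
      = (R - c) + g * (∫ z, φ z ∂(empirical x) - ∫ z, φ z ∂(S.PhiN n h.last)) := fun x => by
    have := S.fluctuation_eq hA1 hN n hφ h x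
    rw [prodGN_succ, prodGN_succ_eq_gammaN] at this
    rw [← this]
    ring
  let f : (Fin N → E (n + 1)) → ℂ := fun x => Complex.exp
        (((t * (√(N : ℝ) * (g * (∫ z, φ z ∂(empirical x) - ∫ z, φ z ∂(S.PhiN n h.last)))) : ℝ)
          : ℂ) * Complex.I)
  have hfm : Measurable f := by
    have := measurable_integral_empirical (N := N) hm
    fun_prop
  have hfi : Integrable f (Measure.pi fun _ : Fin N => S.PhiN n h.last) :=
    integrable_of_measurable_bdd hfm fun x => norm_cexp_mul_I_le _
  set a := Complex.exp (((t * (√(N : ℝ) * (R - c)) : ℝ) : ℂ) * Complex.I) with ha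
  set b := Complex.exp (((t * (√(N : ℝ) * (U - c)) : ℝ) : ℂ) * Complex.I) with hb
  set e := ((Real.exp (-(t ^ 2 * σ) / 2) : ℝ) : ℂ) with he
  set e' := ((Real.exp (-(t ^ 2 * (g ^ 2 * Var[φ; S.PhiN n h.last])) / 2) : ℝ) : ℂ) with he'
  have hsplit : ∀ x, Complex.exp (((t * (√(N : ℝ) * (S.gammaN N (n + 1) φ (h, x) - c)) : ℝ) : ℂ)
      * Complex.I) = a * f x := fun x => by
    rw [hF, ha, ← Complex.exp_add]
    congr 1
    push_cast
    ring
  simp_rw [hsplit]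
  rw [integral_sub (hfi.const_mul a) (integrable_const _), integral_const_mul]
  simp only [integral_const, probReal_univ, one_smul]
  -- Here a and b are the phases of R and of its linearisation, e' and e the Gaussian factors with
  -- conditional and limiting variance; all are bounded by 1, so the three differences add up.
  have hdec : a * ∫ x, f x ∂(Measure.pi fun _ : Fin N => S.PhiN n h.last) - b * e
      = a * (∫ x, f x ∂(Measure.pi fun _ : Fin N => S.PhiN n h.last) - e') + a * (e' - e)
        + (a - b) * e := by ring
  rw [hdec]
  have ha1 : ‖a‖ ≤ 1 := norm_cexp_mul_I_le _
  have he1 : ‖e‖ ≤ 1 := by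
    rw [he, Complex.norm_real, Real.norm_eq_abs, Real.abs_exp, Real.exp_le_one_iff]
    have : 0 ≤ t ^ 2 * σ := by positivity
    linarith
  have hee : ‖e' - e‖ ≤ t ^ 2 / 2 * |g ^ 2 * Var[φ; S.PhiN n h.last] - σ| := by
    rw [he, he', ← Complex.ofReal_sub, Complex.norm_real]
    exact abs_exp_neg_half_sub_le (mul_nonneg (sq_nonneg _) (variance_nonneg _ _)) hv0
  have hab : ‖a - b‖ ≤ |t| * (√(N : ℝ) * |R - U|) := by
    refine (norm_cexp_sub_cexp_le _ _).trans (le_of_eq ?_)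
    rw [← abs_of_nonneg hs0, ← abs_mul, ← abs_mul, abs_of_nonneg hs0]
    congr 1
    ring
  refine (norm_add₃_le).trans (add_le_add_three ?_ ?_ ?_)
  · rw [norm_mul]
    exact (mul_le_of_le_one_left (norm_nonneg _) ha1).trans key
  · rw [norm_mul]
    exact (mul_le_of_le_one_left (norm_nonneg _) ha1).trans hee
  · rw [norm_mul]
    exact (mul_le_of_le_one_right (norm_nonneg _) he1).trans hab

theorem integral_const_add_mul_add_mul {X : Type*} [MeasurableSpace X] {μ : Measure X}
    [IsProbabilityMeasure μ] {f g : X → ℝ} (hf : Integrable f μ) (hg : Integrable g μ)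
    (c a b s : ℝ) :
    ∫ x, (c + a * f x + b * (s * g x)) ∂μ = c + a * ∫ x, f x ∂μ + b * (s * ∫ x, g x ∂μ) := by
  have h : Integrable (fun x => c + a * f x) μ := (integrable_const c).add (hf.const_mul a)
  rw [integral_add h ((hg.const_mul s).const_mul b),
    integral_add (integrable_const c) (hf.const_mul a), integral_const_mul, integral_const_mul,
    integral_const_mul]
  simp

theorem charFunCLT_succ (S : AdaptiveSMC d E) (hA1 : S.A1) (hA2 : S.A2) (n : ℕ)
    (ih : S.CharFunCLT n) : S.CharFunCLT (n + 1) := by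
  intro φ hφ t
  have hP := fun N => S.isProbabilityMeasure_smcLaw hA1 hA2 N n
  have hP' := fun N => S.isProbabilityMeasure_smcLaw hA1 hA2 N (n + 1)
  have hLb := S.isBddMeasurable_L hA1 hA2 n hφ
  obtain ⟨C, hC⟩ := S.charFunCLT_step_bound hA1 hA2 n hφ t
  set σ := (S.gamma (n + 1)).real Set.univ ^ 2 * Var[φ; S.eta (n + 1)] with hv
  set e := ((Real.exp (-(t ^ 2 * σ) / 2) : ℝ) : ℂ) with he
  have hlim : ((Real.exp (-(t ^ 2 * S.cltVar (n + 1) φ) / 2) : ℝ) : ℂ)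
      = ((Real.exp (-(t ^ 2 * S.cltVar n (S.L n φ)) / 2) : ℝ) : ℂ) * e := by
    rw [he, ← Complex.ofReal_mul, ← Real.exp_add, cltVar]
    congr 2
    ring
  rw [hlim]
  have hmain := (ih (S.L n φ) hLb t).mul_const e
  refine tendsto_of_tendsto_of_dist hmain ?_
  have hvar := S.rootSmall_conditional_variance hA1 hA2 n hφ
  have hrem := S.tendsto_sqrt_mul_integral_remainder hA1 hA2 n hφ
  have hbd : Tendsto (fun N : ℕ => C / √(N : ℝ) + t ^ 2 / 2 * (∫ h,
      |(S.gammaN N n (S.Q n (S.thetaN n h.last) fun _ => 1) h *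
          S.gammaN N n (S.Q n (S.thetaN n h.last) fun x => φ x ^ 2) h
        - S.gammaN N n (S.Q n (S.thetaN n h.last) φ) h ^ 2) - σ| ∂(S.smcLaw N n))
      + |t| * (√(N : ℝ) * ∫ h, |S.gammaN N n (S.Q n (S.thetaN n h.last) φ) h
            - S.gammaN N n (S.L n φ) h| ∂(S.smcLaw N n))) atTop (𝓝 0) := by
    simpa using ((tendsto_const_div_sqrt C).add (hvar.tendsto_integral_abs.const_mul
      (t ^ 2 / 2))).add (hrem.const_mul |t|)
  refine squeeze_zero' (Eventually.of_forall fun N => dist_nonneg) ?_ hbd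
  filter_upwards [eventually_gt_atTop 0] with N hN
  have hfst : Measurable (fun h : Hist (fun p => Fin N → E p) (n + 1) => h.1) := measurable_fst
  have mU := S.measurable_gammaN hA2 hN n hLb.1
  have mF := S.measurable_gammaN hA2 hN (n + 1) hφ.1
  have i1 := hvar.1.abs.integrable (P := fun N => S.smcLaw N n) hN
  have i2 := ((S.bddSeq_gammaN_Q_thetaN hA1 hA2 n hφ).sub
    (S.bddSeq_gammaN hA1 hA2 n hLb)).abs.integrable (P := fun N => S.smcLaw N n) hN
  let f₁ : Hist (fun p => Fin N → E p) (n + 1) → ℂ := fun h =>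
    Complex.exp (((t * (√(N : ℝ) * (S.gammaN N (n + 1) φ h
      - ∫ x, φ x ∂(S.gamma (n + 1)))) : ℝ) : ℂ) * Complex.I)
  let f₂ : Hist (fun p => Fin N → E p) n → ℂ := fun h =>
    Complex.exp (((t * (√(N : ℝ) * (S.gammaN N n (S.L n φ) h
      - ∫ x, S.L n φ x ∂(S.gamma n))) : ℝ) : ℂ) * Complex.I) * e
  have hf₁ : Measurable f₁ := by fun_prop
  have hf₂ : Measurable f₂ := by fun_prop
  have hf₂' : Measurable (fun h : Hist (fun p => Fin N → E p) (n + 1) => f₂ h.1) := hf₂.comp hfst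
  have bf₁ : ∀ h, ‖f₁ h‖ ≤ 1 := fun h => norm_cexp_mul_I_le _
  have bf₂ : ∀ h, ‖f₂ h‖ ≤ ‖e‖ := fun h => by
    rw [norm_mul]
    exact mul_le_of_le_one_left (norm_nonneg _) (norm_cexp_mul_I_le _)
  have hpr := fun h : Hist (fun p => Fin N → E p) n => S.isProbabilityMeasure_PhiN hA1 hN n h.last
  -- `f₂` sees only the history, so it can be integrated under the law at time n + 1 and subtracted
  -- under one integral.
  have hlift : ∫ h, f₂ h ∂(S.smcLaw N n) = ∫ h, f₂ h.1 ∂(S.smcLaw N (n + 1)) := by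
    refine ((S.integral_smcLaw_succ hA1 hA2 N n (f := fun h => f₂ h.1) hf₂' (C := ‖e‖)
      fun h => bf₂ h.1).trans ?_).symm
    simp
  rw [dist_comm, dist_eq_norm, ← integral_mul_const]
  change ‖∫ h, f₁ h ∂(S.smcLaw N (n + 1)) - ∫ h, f₂ h ∂(S.smcLaw N n)‖ ≤ _
  rw [hlift, ← integral_sub (integrable_of_measurable_bdd hf₁ bf₁)
    (integrable_of_measurable_bdd (μ := S.smcLaw N (n + 1)) hf₂' fun h => bf₂ h.1),
    S.integral_smcLaw_succ hA1 hA2 N n (f := fun h => f₁ h - f₂ h.1) (hf₁.sub hf₂') (C := 1 + ‖e‖)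
      fun h => (norm_sub_le _ _).trans (add_le_add (bf₁ h) (bf₂ h.1))]
  refine (norm_integral_le_of_norm_le ?_ (Eventually.of_forall (hC N hN))).trans (le_of_eq ?_)
  · exact ((integrable_const _).add (i1.const_mul _)).add ((i2.const_mul _).const_mul _)
  · exact integral_const_add_mul_add_mul i1 i2 _ _ _ _

theorem charFunCLT (S : AdaptiveSMC d E) (hA1 : S.A1) (hA2 : S.A2) (n : ℕ) : S.CharFunCLT n := by
  induction n with
  | zero => exact S.charFunCLT_zero
  | succ n ih => exact S.charFunCLT_succ hA1 hA2 n ih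

/-! ### Identification of the variance, and conclusion. -/

/-- The recursive asymptotic variance as a sum over the generations of particles. -/
theorem cltVar_eq_sum (S : AdaptiveSMC d E) (n : ℕ) (φ : ∀ m, E m → ℝ) :
    S.cltVar n (φ n) = ∑ p ∈ Finset.range (n + 1),
      (S.gamma p).real Set.univ ^ 2 * Var[S.Lcomp p (n - p) (φ (p + (n - p))); S.eta p] := by
  -- Test functions come as a family over all times, which avoids a transport along p + (n - p) = n;
  -- the step shifts the family to m ↦ 𝓛(φ_{m+1}).
  induction n generalizing φ with
  | zero => simp [cltVar, Lcomp]
  | succ n ih =>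
    have h := ih fun m => S.L m (φ (m + 1))
    rw [cltVar, h, Finset.sum_range_succ _ (n + 1), add_comm]
    congr 1
    · refine Finset.sum_congr rfl fun p hp => ?_
      have hp' : n + 1 - p = (n - p) + 1 := by
        have := Finset.mem_range.1 hp
        omega
      rw [hp']
      rfl
    · rw [Nat.sub_self]
      rfl

theorem gamma_real_succ (S : AdaptiveSMC d E) (hA1 : S.A1) (n : ℕ) :
    (S.gamma (n + 1)).real Set.univ =
      (S.gamma n).real Set.univ * ∫ x, S.G n (S.theta n) x ∂(S.eta n) := by
  have h := S.integral_gamma_succ hA1 n (isBddMeasurable_const 1)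
  simp_rw [Q_one] at h
  rw [S.integral_gamma hA1 n] at h
  simpa using h

theorem gamma_real_eq_mul_prod (S : AdaptiveSMC d E) (hA1 : S.A1) {p n : ℕ} (hpn : p ≤ n) :
    (S.gamma n).real Set.univ = (S.gamma p).real Set.univ *
      ∏ k ∈ Finset.Ico p n, ∫ x, S.G k (S.theta k) x ∂(S.eta k) := by
  induction n, hpn using Nat.le_induction with
  | base => simp
  | succ n hpn ih =>
    rw [Finset.prod_Ico_succ_top hpn, ← mul_assoc, ← ih, S.gamma_real_succ hA1]

theorem asympVar_eq (S : AdaptiveSMC d E) (hA1 : S.A1) (n : ℕ) :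
    S.asympVar n = S.cltVar n (fun _ => 1) / (S.gamma n).real Set.univ ^ 2 := by
  rw [S.cltVar_eq_sum n fun _ _ => 1, Finset.sum_div, asympVar]
  refine Finset.sum_congr rfl fun p hp => ?_
  have hpos := S.gamma_real_pos hA1 p
  rw [S.gamma_real_eq_mul_prod hA1 (Nat.lt_succ_iff.1 (Finset.mem_range.1 hp)), mul_pow,
    Finset.prod_pow, mul_div_mul_left _ _ (by positivity)]

theorem asympVar_nonneg (S : AdaptiveSMC d E) (n : ℕ) : 0 ≤ S.asympVar n :=
  Finset.sum_nonneg fun _ _ => div_nonneg (variance_nonneg _ _)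
    (Finset.prod_nonneg fun _ _ => sq_nonneg _)

/-- Convergence in distribution asks for measurability at N = 0 too, where the history space has at
most one point. -/
theorem measurable_gammaN_one (S : AdaptiveSMC d E) (hA2 : S.A2) (N n : ℕ) :
    Measurable (S.gammaN N n fun _ => 1) := by
  rcases N.eq_zero_or_pos with rfl | hN
  · have hs : ∀ m, Subsingleton (Hist (fun p => Fin 0 → E p) m) := fun m => by
      induction m with
      | zero => exact inferInstanceAs (Subsingleton (Fin 0 → E 0))
      | succ m ih => exact inferInstanceAs (Subsingleton (_ × (Fin 0 → E (m + 1))))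
    have := hs n
    exact Subsingleton.measurable
  · exact S.measurable_gammaN hA2 hN n measurable_const

end AdaptiveSMC

theorem mainTheorem8 {d : ℕ} {E : ℕ → Type*} [∀ n, MeasurableSpace (E n)]
    (S : AdaptiveSMC d E) (hA1 : S.A1) (hA2 : S.A2) (n : ℕ) :
    ∃ _ : ∀ N : ℕ, IsProbabilityMeasure (S.smcLaw N n),
      TendstoInDistribution
        (fun (N : ℕ) (h : Hist (fun p => Fin N → E p) n) =>
          √(N : ℝ) * (S.gammaN N n (fun _ => 1) h / (∫ _, (1 : ℝ) ∂(S.gamma n)) - 1))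
        atTop
        (id : ℝ → ℝ)
        (fun N : ℕ => S.smcLaw N n)
        (gaussianReal 0 (S.asympVar n).toNNReal) := by
  have hprob := fun N => S.isProbabilityMeasure_smcLaw hA1 hA2 N n
  refine ⟨hprob, ?_⟩
  have hmeas : ∀ N : ℕ, Measurable (fun h : Hist (fun p => Fin N → E p) n =>
      √(N : ℝ) * (S.gammaN N n (fun _ => 1) h / (∫ _, (1 : ℝ) ∂(S.gamma n)) - 1)) := fun N =>
    (((S.measurable_gammaN_one hA2 N n).div_const _).sub_const _).const_mul _
  have hg := S.gamma_real_pos hA1 n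
  have hγ : ∫ _, (1 : ℝ) ∂(S.gamma n) = (S.gamma n).real Set.univ := by simp
  refine ⟨fun N => (hmeas N).aemeasurable, aemeasurable_id, ?_⟩
  -- Lévy's continuity theorem; the division by γ_n(1) is absorbed into the frequency t/γ_n(1).
  refine ProbabilityMeasure.tendsto_iff_tendsto_charFun.2 fun t => ?_
  have hclt := S.charFunCLT hA1 hA2 n (fun _ => 1) (AdaptiveSMC.isBddMeasurable_const 1)
    (t / (S.gamma n).real Set.univ)
  convert hclt using 1
  · ext N
    simp only [ProbabilityMeasure.coe_mk]
    rw [charFun_apply_real, integral_map (hmeas N).aemeasurable (by fun_prop)]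
    congr 1 with h
    rw [hγ]
    congr 1
    push_cast
    have hg' : ((S.gamma n).real Set.univ : ℂ) ≠ 0 := by exact_mod_cast hg.ne'
    field_simp
  · simp only [ProbabilityMeasure.coe_mk]
    rw [Measure.map_id, charFun_gaussianReal, Real.coe_toNNReal _ (S.asympVar_nonneg n),
      S.asympVar_eq hA1 n]
    push_cast
    congr 2
    field_simp
    ring
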